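/- Let $\mathbb{N}=\{1,2,\dots\}$. Two languages are regarded as equal if they agree up to the empty word $\lambda$. All alphabets, rule sets and label sets below are finite, and $x\Rightarrow_i y$ means that $y$ arises from $x$ by rewriting one occurrence of a nonterminal by a rule of the set $P_i$. A *programmed grammar* (without appearance checking) has disjoint alphabets $N$ of nonterminals and $T$ of terminals, a start symbol $S\in N$, a set $\Lambda$ of labels, a context-free rule for each label $r\in\Lambda$, and a success field $\sigma(r)\subseteq\Lambda$ for each $r\in\Lambda$. A step $(x,r)\Rightarrow(y,r')$ applies the rule of $r$ to one occurrence of its left-hand side in $x$, and $r'\in\sigma(r)$. It generates all $w\in T^*$ with $(S,r_1)\Rightarrow^*(w,r_2)$ for some $r_1,r_2\in\Lambda$. A *hybrid CD grammar system* consists of disjoint alphabets $N$, $T$, a start symbol $S\in N$, and $n\ge 1$ (arbitrarily many, but finitely many) components $(P_i,f_i)$, where $P_i$ is a set of context-free rules and $f_i$ is a mode. A turn $x\Rightarrow_i^{f_i}y$ of component $i$ is a sequence of $s\ge 0$ steps $\Rightarrow_i$ from $x$ to $y$ that obeys $f_i$: the mode $=k$, $\le k$, $\ge k$ requires $s=k$,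 $s\le k$, $s\ge k$, respectively, the mode $t$ requires that there is no $z$ with $y\Rightarrow_i z$, and $(f\wedge f')$ requires both conditions. The system generates all $w\in T^*$ that are obtained from $S$ by a finite nonempty sequence of turns. If all components work in the same mode $f$, it is a *CD grammar system* in mode $f$. The index of a derivation of a terminal word is the maximal number of occurrences of nonterminals in a sentential form of the derivation (for grammar systems, in all sentential forms between single rewriting steps). The index of a word $w$ in $G$ is the minimum over its derivations in $G$, the index of $G$ is the supremum over the words in $L(G)$, and the index of a language with respect to a class of grammars is the infimum over the grammars of that class that generate it. Let $\mathcal{L}_m(\mathrm{P},\mathrm{CF})$, $\mathcal{L}_m(\mathrm{CD}_\infty,\mathrm{CF},f)$ and $\mathcal{L}_m(\mathrm{HCD}_\infty,\mathrm{CF},F)$ be the families of languages that are generated by programmed grammars without appearance checking, by CD grammar systems in mode $f$, and by hybrid CD grammar systems all of whose modes lie in $F$, respectively, and whose index with respect to that class of grammars is at most $m$. With $\mathrm{CF}-\lambda$ in place of $\mathrm{CF}$, only grammars without erasing rules $A\to\lambda$ are admitted. **Theorem.** Let $m\in\mathbb{N}$, let $$FI=\{t\}\cup\{=m'',\ \ge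 m'',\ (\ge m''\wedge\le m'),\ (t\wedge=k),\ (t\wedge\le k),\ (t\wedge\ge k)\mid m',m'',k\in\mathbb{N},\ m'\ge m''\ge m\},$$ and let $F=\{(t\wedge=k),(t\wedge\le k)\mid k\in\mathbb{N}\}$. Then for every $f\in FI$ $$\mathcal{L}_m(\mathrm{P},\mathrm{CF})=\mathcal{L}_m(\mathrm{CD}_\infty,\mathrm{CF},f)=\mathcal{L}_m(\mathrm{HCD}_\infty,\mathrm{CF},F),$$ and the same equalities hold with $\mathrm{CF}-\lambda$ in place of $\mathrm{CF}$ throughout. -/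

import Mathlib

universe u

namespace GrammarSystems

/-- Sentential forms: words over the disjoint union of the terminals `T` and the
nonterminals `N`. -/
abbrev Form (T N : Type u) : Type u := List (Symbol T N)

/-- Does a symbol of the working alphabet belong to the nonterminal alphabet? -/
def isNonterminal {T N : Type u} : Symbol T N → Bool
  | .terminal _ => false
  | .nonterminal _ => true

/-- The number of occurrences of nonterminals in a sentential form. -/
def ntCount {T N : Type u} (x : Form T N) : ℕ := x.countP isNonterminal

/-- A terminal word, seen as a sentential form. -/
def ofWord {T : Type u} (N : Type u) (w : List T) : Form T N := w.map Symbol.terminal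

/-- The index of a sequence of sentential forms: the largest number of nonterminal occurrences
in one of them. -/
def formsIndex {T N : Type u} (D : List (Form T N)) : ℕ := (D.map ntCount).foldr max 0

/-- The two rule types: arbitrary context-free rules, and context-free rules that are not
erasing. -/
inductive RuleType
  | CF
  | CFLambdaFree

/-- Is a context-free rule `A → z` of the given type? -/
def RuleType.Allows {T N : Type u} : RuleType → ContextFreeRule T N → Prop
  | .CF, _ => True
  | .CFLambdaFree, r => r.output ≠ []

/-- Two languages are considered equal if they agree up to the empty word. -/
def SameLanguage {T : Type u} (L₁ L₂ : Language T) : Prop :=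
  ∀ w : List T, w ≠ [] → (w ∈ L₁ ↔ w ∈ L₂)

/-! ### Index of words, grammars and languages, for an arbitrary kind of grammars

Below, `γ` is a type of grammars with terminal alphabet `T`, and `der G w n` says that `G` has a
derivation of the terminal word `w` of index `n`. -/

section Index

variable {T : Type u} {γ : Type*} (der : γ → List T → ℕ → Prop)

/-- The generated language: all terminal words that have a derivation. -/
def generated (G : γ) : Language T := {w : List T | ∃ n, der G w n}

/-- The minimal index of a derivation of `w` in `G`. -/
noncomputable def wordIndex (G : γ) (w : List T) : ℕ∞ :=
  sInf {e : ℕ∞ | ∃ n : ℕ, der G w n ∧ e = n}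

/-- The index of the grammar `G`: supremum over all words of the generated language. -/
noncomputable def grammarIndex (G : γ) : ℕ∞ :=
  sSup {e : ℕ∞ | ∃ w ∈ generated der G, e = wordIndex der G w}

/-- The index of the language `L` with respect to the class `X` of grammars: infimum over all
grammars in `X` that generate `L`. -/
noncomputable def languageIndex (X : Set γ) (L : Language T) : ℕ∞ :=
  sInf {e : ℕ∞ | ∃ G ∈ X, SameLanguage (generated der G) L ∧ e = grammarIndex der G}

/-- The languages generated by grammars in `X`. -/
def family (X : Set γ) : Set (Language T) :=
  {L | ∃ G ∈ X, SameLanguage (generated der G) L}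

/-- The languages generated by grammars in `X` that have index at most `m` with respect to `X`. -/
def familyOfIndex (X : Set γ) (m : ℕ) : Set (Language T) :=
  {L | L ∈ family der X ∧ languageIndex der X L ≤ m}

end Index

/-! ### Programmed grammars -/

/-- A programmed grammar with terminal alphabet `T`. The finite set of rules is the range of
the labelling function `rule`. -/
structure ProgrammedGrammar (T : Type u) where
  NT : Type u
  finite_NT : Finite NT
  start : NT
  Label : Type u
  finite_Label : Finite Label
  rule : Label → ContextFreeRule T NT
  /-- success field -/
  success : Label → Set Label
  /-- failure field -/
  failure : Label → Set Label

namespace ProgrammedGrammar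

variable {T : Type u} (G : ProgrammedGrammar T)

/-- A derivation step `(x, r₁) ⇒ (y, r₂)`. -/
def Step (c d : Form T G.NT × G.Label) : Prop :=
  ((G.rule c.2).Rewrites c.1 d.1 ∧ d.2 ∈ G.success c.2) ∨
  (c.1 = d.1 ∧ (¬ ∃ z, (G.rule c.2).Rewrites c.1 z) ∧ d.2 ∈ G.failure c.2)

/-- The sequence of configurations `c, D₁, D₂, …` is a derivation starting in `c` and
ending in `d`. -/
def Derives (c : Form T G.NT × G.Label) (D : List (Form T G.NT × G.Label))
    (d : Form T G.NT × G.Label) : Prop :=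
  List.IsChain G.Step (c :: D) ∧ (c :: D).getLast (List.cons_ne_nil c D) = d

/-- `G` has a derivation of `w` of index `n`. -/
def DerivesWord (w : List T) (n : ℕ) : Prop :=
  ∃ (r₁ r₂ : G.Label) (D : List (Form T G.NT × G.Label)),
    G.Derives ([Symbol.nonterminal G.start], r₁) D (ofWord G.NT w, r₂) ∧
    n = formsIndex ([Symbol.nonterminal G.start] :: D.map Prod.fst)

end ProgrammedGrammar

/-- Programmed grammars with rules of type `X`, without appearance checking. -/
def programmedClass (T : Type u) (X : RuleType) : Set (ProgrammedGrammar T) :=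
  {G | (∀ r, X.Allows (G.rule r)) ∧ ∀ r, G.failure r = ∅}

/-- Languages of index at most `m` for programmed grammars with rules of type `X`, without
appearance checking. -/
def programmedFamily (T : Type u) (X : RuleType) (m : ℕ) : Set (Language T) :=
  familyOfIndex ProgrammedGrammar.DerivesWord (programmedClass T X) m

/-! ### Hybrid cooperating distributed grammar systems -/

/-- The classical basic modes `∗`, `t`, `≤ k`, `= k`, `≥ k`. -/
inductive BasicMode
  | star
  | t
  | le (k : ℕ)
  | eq (k : ℕ)
  | ge (k : ℕ)

/-- Derivation modes: basic modes and conjunctions of two basic modes. -/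
inductive Mode
  | basic (f : BasicMode)
  | and (f₁ f₂ : BasicMode)

/-- The condition a basic mode imposes on a derivation of `n` steps; `stuck` says that the
component cannot be applied to the final sentential form. -/
def BasicMode.Holds : BasicMode → ℕ → Prop → Prop
  | .star, _, _ => True
  | .t, _, stuck => stuck
  | .le k, n, _ => n ≤ k
  | .eq k, n, _ => n = k
  | .ge k, n, _ => k ≤ n

/-- The condition a mode imposes on a derivation of `n` steps. -/
def Mode.Holds : Mode → ℕ → Prop → Prop
  | .basic f, n, stuck => f.Holds n stuck
  | .and f₁ f₂, n, stuck => f₁.Holds n stuck ∧ f₂.Holds n stuck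

/-- A hybrid cooperating distributed grammar system with terminal alphabet `T`. -/
structure HCDSystem (T : Type u) where
  NT : Type u
  finite_NT : Finite NT
  start : NT
  degree : ℕ
  one_le_degree : 1 ≤ degree
  rules : Fin degree → Finset (ContextFreeRule T NT)
  mode : Fin degree → Mode

namespace HCDSystem

variable {T : Type u} (G : HCDSystem T)

/-- A single rewriting step `x ⇒ᵢ y` of the `i`-th component. -/
def Step (i : Fin G.degree) (x y : Form T G.NT) : Prop :=
  ∃ r ∈ G.rules i, r.Rewrites x y

/-- The sequence `x, D₁, D₂, …` of sentential forms consists of single steps of the `i`-th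
component, leads from `x` to `y`, and obeys the mode of that component. -/
def ModeStep (i : Fin G.degree) (x : Form T G.NT) (D : List (Form T G.NT)) (y : Form T G.NT) :
    Prop :=
  List.IsChain (G.Step i) (x :: D) ∧ (x :: D).getLast (List.cons_ne_nil x D) = y ∧
    (G.mode i).Holds D.length (¬ ∃ z, G.Step i y z)

/-- The sequence `x, D₁, D₂, …` of sentential forms is a derivation from `x` to `y`: a
concatenation of one or more turns of components, each in its mode. All
sentential forms between the single rewriting steps are recorded. -/
inductive Derives : Form T G.NT → List (Form T G.NT) → Form T G.NT → Prop
  | single {x y : Form T G.NT} {D : List (Form T G.NT)} (i : Fin G.degree)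
      (h : G.ModeStep i x D y) : Derives x D y
  | cons {x y z : Form T G.NT} {D E : List (Form T G.NT)} (i : Fin G.degree)
      (h : G.ModeStep i x D y) (h' : Derives y E z) : Derives x (D ++ E) z

/-- `G` has a derivation of `w` of index `n`. -/
def DerivesWord (w : List T) (n : ℕ) : Prop :=
  ∃ D : List (Form T G.NT), G.Derives [Symbol.nonterminal G.start] D (ofWord G.NT w) ∧
    n = formsIndex ([Symbol.nonterminal G.start] :: D)

end HCDSystem

/-- Hybrid CD grammar systems (with any number of components) whose rules are of type `X`, each
component working in one of the modes in `F`. -/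
def hcdClass (T : Type u) (X : RuleType) (F : Set Mode) : Set (HCDSystem T) :=
  {G | (∀ i, ∀ r ∈ G.rules i, X.Allows r) ∧ ∀ i, G.mode i ∈ F}

/-- Languages of index at most `m` for hybrid CD grammar systems with modes in `F`. -/
def hcdFamily (T : Type u) (X : RuleType) (F : Set Mode) (m : ℕ) : Set (Language T) :=
  familyOfIndex HCDSystem.DerivesWord (hcdClass T X F) m

/-- Languages of index at most `m` for CD grammar systems all of whose components work in
the mode `f`. -/
def cdFamily (T : Type u) (X : RuleType) (f : Mode) (m : ℕ) : Set (Language T) :=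
  hcdFamily T X {f} m

/-- The modes `t`, `= m''`, `≥ m''`, `(≥ m'' ∧ ≤ m')`, `(t ∧ = k)`, `(t ∧ ≤ k)`, `(t ∧ ≥ k)`
with `m' ≥ m'' ≥ m` and `k ≥ 1`. -/
inductive FI (m : ℕ) : Mode → Prop
  | t : FI m (.basic .t)
  | eq (m'' : ℕ) (h : m ≤ m'') : FI m (.basic (.eq m''))
  | ge (m'' : ℕ) (h : m ≤ m'') : FI m (.basic (.ge m''))
  | geLe (m'' m' : ℕ) (h : m ≤ m'') (h' : m'' ≤ m') : FI m (.and (.ge m'') (.le m'))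
  | tEq (k : ℕ) (h : 1 ≤ k) : FI m (.and .t (.eq k))
  | tLe (k : ℕ) (h : 1 ≤ k) : FI m (.and .t (.le k))
  | tGe (k : ℕ) (h : 1 ≤ k) : FI m (.and .t (.ge k))

/-- The internally hybrid modes `(t ∧ = k)` and `(t ∧ ≤ k)` with `k ≥ 1`. -/
def hybridModes : Set Mode :=
  {f | ∃ k : ℕ, 1 ≤ k ∧ (f = .and .t (.eq k) ∨ f = .and .t (.le k))}

end GrammarSystems

/-! A derivation of index at most `m` never holds more than `m` nonterminal occurrences, so these
can be kept in `m` numbered slots, with the nonterminal in each slot remembered by a finite control.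
The common normal form is `SlotSystem`: an automaton on forms in which the state determines which
slots occur, each exactly once. An edge is then applicable as soon as its source is the current
state, and nothing has to be tested for appearance.

Into the normal form: `ControlledGrammar.exists_slotSystem` treats every finite control that may
test the set of nonterminals present, because with slots this set is a function of the state.
Programmed grammars are of this kind. So are hybrid systems in arbitrary modes: the control stores
the active component and a capped step counter, and the test decides whether the component is stuck.

Out of the normal form: for programmed grammars the edges become labels. In a grammar system the
nonterminals themselves must carry the state, and the danger is a form in which only some slots have
changed it. For modes that imply maximality (`SlotSystem.mem_cdFamily_of_maximal`), rules `B → B`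
for all forbidden `B` keep a component from getting stuck while a wrong tag is present, so a turn
changes one tag and tests all the others. For modes that require at least `M ≥ m` steps
(`SlotSystem.mem_cdFamily_of_counted`), the slots share exactly `M` steps by means of counters, so a
turn must exhaust them and traverse its edge completely.

Soundness of these constructions concerns derivations of any index; completeness supplies
derivations of index at most `m`. All auxiliary rules are non-erasing, so both rule types are
covered at once. -/

namespace GrammarSystems

open Relation

/-! ### Nonterminals of a sentential form and renaming -/

section Forms

variable {T N N' N'' : Type u}

/-- The sequence of the nonterminal occurrences of a sentential form. -/
def nts : Form T N → List N
  | [] => []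
  | .terminal _ :: x => nts x
  | .nonterminal A :: x => A :: nts x

@[simp] theorem nts_nil : nts ([] : Form T N) = [] := rfl

@[simp] theorem nts_terminal_cons (a : T) (x : Form T N) : nts (.terminal a :: x) = nts x := rfl

@[simp] theorem nts_nonterminal_cons (A : N) (x : Form T N) :
    nts (.nonterminal A :: x) = A :: nts x := rfl

@[simp] theorem nts_append (x y : Form T N) : nts (x ++ y) = nts x ++ nts y := by
  induction x with
  | nil => rfl
  | cons s x ih => cases s <;> simp [ih]

theorem ntCount_eq_length (x : Form T N) : ntCount x = (nts x).length := by
  induction x with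
  | nil => rfl
  | cons s x ih =>
    unfold ntCount at *
    cases s <;> simp [List.countP_cons, isNonterminal, ih]

@[simp] theorem nts_ofWord (w : List T) : nts (ofWord N w) = [] := by
  induction w with
  | nil => rfl
  | cons a w ih => simpa [ofWord] using ih

theorem exists_ofWord_of_nts_eq_nil {x : Form T N} (h : nts x = []) : ∃ w, x = ofWord N w := by
  induction x with
  | nil => exact ⟨[], rfl⟩
  | cons s x ih =>
    cases s with
    | terminal a => obtain ⟨w, rfl⟩ := ih h; exact ⟨a :: w, rfl⟩
    | nonterminal A => simp at h

theorem exists_eq_append_of_mem_nts {x : Form T N} {A : N} (h : A ∈ nts x) :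
    ∃ p q, x = p ++ [.nonterminal A] ++ q := by
  induction x with
  | nil => simp at h
  | cons s x ih =>
    cases s with
    | terminal a =>
      obtain ⟨p, q, rfl⟩ := ih h
      exact ⟨.terminal a :: p, q, rfl⟩
    | nonterminal B =>
      rcases List.mem_cons.1 h with rfl | h
      · exact ⟨[], x, rfl⟩
      · obtain ⟨p, q, rfl⟩ := ih h
        exact ⟨.nonterminal B :: p, q, rfl⟩

/-- Renaming of the nonterminals of a sentential form. -/
def mapNT (f : N → N') : Form T N → Form T N'
  | [] => []
  | .terminal a :: x => .terminal a :: mapNT f x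
  | .nonterminal A :: x => .nonterminal (f A) :: mapNT f x

@[simp] theorem mapNT_nil (f : N → N') : mapNT f ([] : Form T N) = [] := rfl

@[simp] theorem mapNT_terminal_cons (f : N → N') (a : T) (x : Form T N) :
    mapNT f (.terminal a :: x) = .terminal a :: mapNT f x := rfl

@[simp] theorem mapNT_nonterminal_cons (f : N → N') (A : N) (x : Form T N) :
    mapNT f (.nonterminal A :: x) = .nonterminal (f A) :: mapNT f x := rfl

@[simp] theorem mapNT_append (f : N → N') (x y : Form T N) :
    mapNT f (x ++ y) = mapNT f x ++ mapNT f y := by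
  induction x with
  | nil => rfl
  | cons s x ih => cases s <;> simp [ih]

@[simp] theorem nts_mapNT (f : N → N') (x : Form T N) : nts (mapNT f x) = (nts x).map f := by
  induction x with
  | nil => rfl
  | cons s x ih => cases s <;> simp [ih]

@[simp] theorem length_mapNT (f : N → N') (x : Form T N) : (mapNT f x).length = x.length := by
  induction x with
  | nil => rfl
  | cons s x ih => cases s <;> simp [ih]

theorem mapNT_eq_nil {f : N → N'} {x : Form T N} : mapNT f x = [] ↔ x = [] := by
  rw [← List.length_eq_zero_iff, length_mapNT, List.length_eq_zero_iff]

@[simp] theorem mapNT_ofWord (f : N → N') (w : List T) : mapNT f (ofWord N w) = ofWord N' w := by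
  induction w with
  | nil => rfl
  | cons a w ih => simpa [ofWord] using ih

@[simp] theorem mapNT_mapNT (g : N' → N'') (f : N → N') (x : Form T N) :
    mapNT g (mapNT f x) = mapNT (fun A => g (f A)) x := by
  induction x with
  | nil => rfl
  | cons s x ih => cases s <;> simp [ih]

theorem mapNT_congr {f g : N → N'} {x : Form T N} (h : ∀ A ∈ nts x, f A = g A) :
    mapNT f x = mapNT g x := by
  induction x with
  | nil => rfl
  | cons s x ih => cases s <;> simp_all

theorem mapNT_eq_self {f : N → N} {x : Form T N} (h : ∀ A ∈ nts x, f A = A) : mapNT f x = x := by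
  induction x with
  | nil => rfl
  | cons s x ih => cases s <;> simp_all

theorem mapNT_injective {f : N → N'} (hf : Function.Injective f) :
    Function.Injective (mapNT (T := T) f) := by
  intro x
  induction x with
  | nil => intro y h; exact (mapNT_eq_nil.1 h.symm).symm
  | cons s x ih =>
    intro y h
    cases y with
    | nil => cases s <;> simp at h
    | cons s' y =>
      cases s <;> cases s' <;> simp at h
      · rw [h.1, ih h.2]
      · rw [hf h.1, ih h.2]

theorem mapNT_eq_append {f : N → N'} {x : Form T N} {p q : Form T N'} (h : mapNT f x = p ++ q) :
    ∃ u v, x = u ++ v ∧ mapNT f u = p ∧ mapNT f v = q := by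
  induction p generalizing x with
  | nil => exact ⟨[], x, rfl, rfl, h⟩
  | cons s p ih =>
    cases x with
    | nil => simp at h
    | cons s' x =>
      cases s' with
      | terminal a =>
        simp only [mapNT_terminal_cons, List.cons_append, List.cons.injEq] at h
        obtain ⟨u, v, rfl, rfl, rfl⟩ := ih h.2
        exact ⟨.terminal a :: u, v, rfl, by simp [h.1], rfl⟩
      | nonterminal A =>
        simp only [mapNT_nonterminal_cons, List.cons_append, List.cons.injEq] at h
        obtain ⟨u, v, rfl, rfl, rfl⟩ := ih h.2
        exact ⟨.nonterminal A :: u, v, rfl, by simp [h.1], rfl⟩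

/-- An occurrence of a nonterminal in a renamed form comes from an occurrence in the form. -/
theorem mapNT_eq_append_nonterminal {f : N → N'} {x : Form T N} {p q : Form T N'} {B : N'}
    (h : mapNT f x = p ++ [.nonterminal B] ++ q) :
    ∃ u A v, x = u ++ [.nonterminal A] ++ v ∧ mapNT f u = p ∧ f A = B ∧ mapNT f v = q := by
  obtain ⟨u', v, rfl, hu', rfl⟩ := mapNT_eq_append h
  obtain ⟨u, s, rfl, rfl, hs⟩ := mapNT_eq_append hu'
  match s, hs with
  | [.nonterminal A], hs =>
    simp only [mapNT_nonterminal_cons, mapNT_nil, List.cons.injEq, Symbol.nonterminal.injEq] at hs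
    exact ⟨u, A, v, rfl, rfl, hs.1, rfl⟩
  | [], hs => simp at hs
  | .terminal a :: _, hs => simp at hs
  | .nonterminal A :: B :: r, hs => have := congrArg List.length hs; simp at this

theorem ofWord_injective : Function.Injective (ofWord (T := T) N) :=
  List.map_injective_iff.2 fun _ _ h => Symbol.terminal.inj h

end Forms

/-! ### Index -/

theorem formsIndex_le_iff {T N : Type u} {D : List (Form T N)} {m : ℕ} :
    formsIndex D ≤ m ↔ ∀ x ∈ D, ntCount x ≤ m := by
  unfold formsIndex
  induction D with
  | nil => simp
  | cons x D ih => simp [ih]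

theorem RuleType.allows_iff {T N : Type u} {X : RuleType} {r : ContextFreeRule T N} :
    X.Allows r ↔ X = .CF ∨ r.output ≠ [] := by
  cases X <;> simp [RuleType.Allows]

/-- A nonempty infimum in `ℕ∞` is attained and the empty one is `⊤`, so a finite bound yields an
actual derivation. -/
theorem wordIndex_le_iff {T : Type u} {γ : Type*} {der : γ → List T → ℕ → Prop} {G : γ}
    {w : List T} {m : ℕ} : wordIndex der G w ≤ m ↔ ∃ n ≤ m, der G w n := by
  constructor
  · intro h
    have hne : {e : ℕ∞ | ∃ n : ℕ, der G w n ∧ e = n}.Nonempty := by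
      by_contra hne
      rw [wordIndex, Set.not_nonempty_iff_eq_empty.1 hne, sInf_empty] at h
      simp at h
    obtain ⟨n, hn, he⟩ := csInf_mem hne
    refine ⟨n, ?_, hn⟩
    rw [wordIndex, he] at h
    exact_mod_cast h
  · rintro ⟨n, hn, h⟩
    exact (sInf_le (show _ ∈ {e : ℕ∞ | ∃ n : ℕ, der G w n ∧ e = n} from ⟨n, h, rfl⟩)).trans
      (by exact_mod_cast hn)

/-- A language has index at most `m` iff it is generated by a grammar of the class all of whose
words have derivations of index at most `m`. -/
theorem mem_familyOfIndex_iff {T : Type u} {γ : Type*} {der : γ → List T → ℕ → Prop}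
    {X : Set γ} {m : ℕ} {L : Language T} :
    L ∈ familyOfIndex der X m ↔ ∃ G ∈ X, SameLanguage (generated der G) L ∧
      ∀ w ∈ generated der G, ∃ n ≤ m, der G w n := by
  constructor
  · rintro ⟨⟨G₀, hG₀, hL₀⟩, hm⟩
    have hne : {e : ℕ∞ | ∃ G ∈ X, SameLanguage (generated der G) L ∧
        e = grammarIndex der G}.Nonempty := ⟨_, G₀, hG₀, hL₀, rfl⟩
    obtain ⟨G, hG, hL, he⟩ := csInf_mem hne
    refine ⟨G, hG, hL, fun w hw => wordIndex_le_iff.1 ?_⟩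
    rw [languageIndex, he] at hm
    exact (le_sSup (show _ ∈ {e | ∃ w ∈ generated der G, e = wordIndex der G w} from
      ⟨w, hw, rfl⟩)).trans hm
  · rintro ⟨G, hG, hL, h⟩
    refine ⟨⟨G, hG, hL⟩, (sInf_le (show _ ∈ {e | ∃ G ∈ X, SameLanguage (generated der G) L ∧
      e = grammarIndex der G} from ⟨G, hG, hL, rfl⟩)).trans (sSup_le ?_)⟩
    rintro _ ⟨w, hw, rfl⟩
    exact wordIndex_le_iff.2 (h w hw)

/-! ### Iterated relations -/

/-- `Iter R n x y`: there is an `R`-path of length `n` from `x` to `y`. -/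
inductive Iter {α : Type*} (R : α → α → Prop) : ℕ → α → α → Prop
  | zero (x : α) : Iter R 0 x x
  | head {n : ℕ} {x y z : α} : R x y → Iter R n y z → Iter R (n + 1) x z

namespace Iter

variable {α : Type*} {R : α → α → Prop}

theorem trans {n k : ℕ} {x y z : α} (h : Iter R n x y) (h' : Iter R k y z) :
    Iter R (n + k) x z := by
  induction h with
  | zero => simpa using h'
  | head hr _ ih => rw [Nat.add_right_comm]; exact .head hr (ih h')

theorem of_eq {n k : ℕ} {x y : α} (h : n = k) (h' : Iter R n x y) : Iter R k x y := h ▸ h'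

theorem single {x y : α} (h : R x y) : Iter R 1 x y := .head h (.zero y)

theorem tail {n : ℕ} {x y z : α} (h : Iter R n x y) (h' : R y z) : Iter R (n + 1) x z :=
  h.trans (single h')

/-- `P` is imposed on the endpoints of steps only, matching the recorded lists, which omit the first
form. -/
theorem exists_isChain {P : α → Prop} {n : ℕ} {x y : α} :
    Iter (fun a b => R a b ∧ P b) n x y ↔ ∃ D : List α, List.IsChain R (x :: D) ∧
      (x :: D).getLast (List.cons_ne_nil x D) = y ∧ D.length = n ∧ ∀ d ∈ D, P d := by
  constructor
  · intro h
    induction h with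
    | zero x => exact ⟨[], by simp⟩
    | head hr _ ih =>
      obtain ⟨D, hc, hl, hn, hP⟩ := ih
      refine ⟨_ :: D, .cons_cons hr.1 hc, ?_, by simp [hn], ?_⟩
      · rw [List.getLast_cons (List.cons_ne_nil _ _)]; exact hl
      · simpa using ⟨hr.2, hP⟩
  · rintro ⟨D, hc, hl, hn, hP⟩
    induction D generalizing x n with
    | nil =>
      obtain rfl : x = y := by simpa using hl
      subst hn
      exact .zero x
    | cons d D ih =>
      subst hn
      rw [List.isChain_cons_cons] at hc
      rw [List.getLast_cons (List.cons_ne_nil _ _)] at hl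
      exact .head ⟨hc.1, hP d (by simp)⟩
        (ih hc.2 hl rfl fun e he => hP e (List.mem_cons_of_mem _ he))

theorem mono {S : α → α → Prop} (hRS : ∀ a b, R a b → S a b) {n : ℕ} {x y : α}
    (h : Iter R n x y) : Iter S n x y := by
  induction h with
  | zero => exact .zero _
  | head hr _ ih => exact .head (hRS _ _ hr) ih

theorem reflTransGen {n : ℕ} {x y : α} (h : Iter R n x y) : Relation.ReflTransGen R x y := by
  induction h with
  | zero => exact .refl
  | head hr _ ih => exact .head hr ih

theorem of_reflTransGen {x y : α} (h : Relation.ReflTransGen R x y) : ∃ n, Iter R n x y := by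
  induction h with
  | refl => exact ⟨0, .zero _⟩
  | tail _ hr ih => obtain ⟨n, hn⟩ := ih; exact ⟨_, hn.tail hr⟩

/-- An invariant that also counts the steps. -/
theorem invariant {I : ℕ → α → Prop} (hI : ∀ n a b, I n a → R a b → I (n + 1) b)
    {n k : ℕ} {x y : α} (h : Iter R n x y) (hx : I k x) : I (k + n) y := by
  induction h generalizing k with
  | zero => exact hx
  | head hr _ ih => rw [← Nat.add_assoc, Nat.add_right_comm]; exact ih (hI _ _ _ hx hr)

end Iter

theorem reflTransGen_invariant {α : Type*} {R : α → α → Prop} {I : α → Prop}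
    (hI : ∀ a b, I a → R a b → I b) {x y : α} (h : Relation.ReflTransGen R x y) (hx : I x) :
    I y := by
  induction h with
  | refl => exact hx
  | tail _ hr ih => exact hI _ _ ih hr

/-! ### Slot systems -/

/-- A finite automaton that rewrites forms whose nonterminals are slots. In a reachable
configuration the slots used by the state occur exactly once each, and there are at most `m`
of them. -/
structure SlotSystem (T : Type u) (m : ℕ) where
  State : Type u
  finite_State : Finite State
  Slot : Type u
  finite_Slot : Finite Slot
  Edge : Type u
  finite_Edge : Finite Edge
  src : Edge → State
  tgt : Edge → State
  slot : Edge → Slot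
  out : Edge → Form T Slot
  start : State
  startSlot : Slot
  used : State → Finset Slot
  used_start : used start = {startSlot}
  card_used : ∀ q, (used q).card ≤ m
  -- No loops: in the grammar systems the tag of a slot must show whether the slot has already been
  -- processed.
  src_ne_tgt : ∀ e, src e ≠ tgt e
  tgt_ne_start : ∀ e, tgt e ≠ start
  slot_mem : ∀ e, slot e ∈ used (src e)
  -- Since `used (tgt e)` has no repetitions, this also forces the slots created by the edge to be
  -- distinct from each other and from the slots that stay.
  balance : ∀ e, (used (tgt e)).val + {slot e} = (used (src e)).val + (nts (out e) : Multiset Slot)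

namespace SlotSystem

variable {T : Type u} {m : ℕ} (H : SlotSystem T m)

/-- A rewriting step along an edge. -/
def Step (a b : H.State × Form T H.Slot) : Prop :=
  ∃ e u v, a = (H.src e, u ++ [.nonterminal (H.slot e)] ++ v) ∧ b = (H.tgt e, u ++ H.out e ++ v)

/-- The initial configuration. -/
def init : H.State × Form T H.Slot := (H.start, [.nonterminal H.startSlot])

/-- Reachability of a configuration. -/
def Reach (a : H.State × Form T H.Slot) : Prop := ReflTransGen H.Step H.init a

/-- The generated language. -/
def language : Language T := {w | ∃ q, H.Reach (q, ofWord H.Slot w)}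

variable {H}

/-- The basic invariant: `balance` says precisely that a step preserves it. It gives both the
uniqueness of occurrences and the index bound. -/
theorem Reach.fits {a : H.State × Form T H.Slot} (h : H.Reach a) :
    (nts a.2 : Multiset H.Slot) = (H.used a.1).val := by
  refine reflTransGen_invariant (I := fun a => (nts a.2 : Multiset H.Slot) = (H.used a.1).val)
    ?_ h ?_
  · rintro _ _ ha ⟨e, u, v, rfl, rfl⟩
    have hb := H.balance e
    simp only [nts_append, ← Multiset.coe_add, nts_nonterminal_cons, nts_nil,
      Multiset.coe_singleton] at ha ⊢
    rw [← ha] at hb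
    refine add_right_cancel (b := ({H.slot e} : Multiset H.Slot)) ?_
    rw [hb]
    abel
  · rw [show H.init.1 = H.start from rfl, H.used_start]; rfl

theorem Reach.nodup {a : H.State × Form T H.Slot} (h : H.Reach a) : (nts a.2).Nodup := by
  rw [← Multiset.coe_nodup, h.fits]
  exact (H.used a.1).nodup

theorem Reach.mem_nts_iff {a : H.State × Form T H.Slot} (h : H.Reach a) {i : H.Slot} :
    i ∈ nts a.2 ↔ i ∈ H.used a.1 := by
  rw [← Multiset.mem_coe, h.fits, Finset.mem_val]

theorem Reach.ntCount_le {a : H.State × Form T H.Slot} (h : H.Reach a) : ntCount a.2 ≤ m := by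
  rw [ntCount_eq_length, ← Multiset.coe_card, h.fits]
  exact H.card_used a.1

theorem Reach.step {e : H.Edge} {u v : Form T H.Slot}
    (h : H.Reach (H.src e, u ++ [.nonterminal (H.slot e)] ++ v)) :
    H.Reach (H.tgt e, u ++ H.out e ++ v) :=
  h.tail ⟨e, u, v, rfl, rfl⟩

/-- The rules of the slot system are of the given type. -/
def Allowed (H : SlotSystem T m) (X : RuleType) : Prop := ∀ e, X = .CF ∨ H.out e ≠ []

end SlotSystem

/-! ### From slot systems to programmed grammars -/

namespace ProgrammedGrammar

variable {T : Type u} (G : ProgrammedGrammar T)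

/-- The condition `1 ≤ m` accounts for the start form, which is not the endpoint of any step. -/
theorem exists_derivesWord_le_iff {m : ℕ} {w : List T} :
    (∃ n ≤ m, G.DerivesWord w n) ↔ 1 ≤ m ∧ ∃ r₁ r₂,
      ReflTransGen (fun c d => G.Step c d ∧ ntCount d.1 ≤ m)
        ([.nonterminal G.start], r₁) (ofWord G.NT w, r₂) := by
  constructor
  · rintro ⟨n, hn, r₁, r₂, D, ⟨hc, hl⟩, rfl⟩
    rw [formsIndex_le_iff] at hn
    refine ⟨hn _ List.mem_cons_self, r₁, r₂, (Iter.exists_isChain.2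
      ⟨D, hc, hl, rfl, fun d hd => hn _ (List.mem_cons_of_mem _ (List.mem_map_of_mem hd))⟩)
      |>.reflTransGen⟩
  · rintro ⟨hm, r₁, r₂, hr⟩
    obtain ⟨n, hn⟩ := Iter.of_reflTransGen hr
    obtain ⟨D, hc, hl, -, hD⟩ := Iter.exists_isChain.1 hn
    refine ⟨_, ?_, r₁, r₂, D, ⟨hc, hl⟩, rfl⟩
    rw [formsIndex_le_iff]
    intro x hx
    rcases List.mem_cons.1 hx with rfl | hx
    · exact hm
    · obtain ⟨d, hd, rfl⟩ := List.mem_map.1 hx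
      exact hD d hd

theorem exists_derivesWord_iff {w : List T} :
    (∃ n, G.DerivesWord w n) ↔ ∃ r₁ r₂,
      ReflTransGen G.Step ([.nonterminal G.start], r₁) (ofWord G.NT w, r₂) := by
  constructor
  · rintro ⟨n, r₁, r₂, D, ⟨hc, hl⟩, -⟩
    exact ⟨r₁, r₂, List.relationReflTransGen_of_exists_isChain_cons D hc hl⟩
  · rintro ⟨r₁, r₂, hr⟩
    obtain ⟨D, hc, hl⟩ := List.exists_isChain_cons_of_relationReflTransGen hr
    exact ⟨_, r₁, r₂, D, ⟨hc, hl⟩, rfl⟩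

end ProgrammedGrammar

namespace SlotSystem

variable {T : Type u} {m : ℕ} (H : SlotSystem T m)

open Classical in
/-- Renaming of the slots: the initial state gets a nonterminal of its own. -/
noncomputable def rename (q : H.State) (i : H.Slot) : Option H.Slot :=
  if q = H.start then none else some i

theorem rename_tgt (e : H.Edge) : H.rename (H.tgt e) = some := by
  funext i; simp [rename, H.tgt_ne_start]

/-- The rules of the simulating programmed grammar. -/
noncomputable def programmedRule : Option H.Edge → ContextFreeRule T (Option H.Slot)
  | none => ⟨none, [.nonterminal none]⟩
  | some e => ⟨H.rename (H.src e) (H.slot e), mapNT some (H.out e)⟩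

/-- The success fields of the simulating programmed grammar. -/
def programmedSuccess : Option H.Edge → Set (Option H.Edge)
  | none => ∅
  | some e => {l | ∀ e', l = some e' → H.src e' = H.tgt e}

/-- The programmed grammar whose labels are the edges, and one more label to stop. -/
noncomputable def toProgrammed : ProgrammedGrammar T where
  NT := Option H.Slot
  finite_NT := have := H.finite_Slot; inferInstance
  start := none
  Label := Option H.Edge
  finite_Label := have := H.finite_Edge; inferInstance
  rule := H.programmedRule
  success := H.programmedSuccess
  failure _ := ∅

theorem toProgrammed_mem {X : RuleType} (hX : H.Allowed X) :
    H.toProgrammed ∈ programmedClass T X := by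
  refine ⟨fun l => RuleType.allows_iff.2 ?_, fun _ => rfl⟩
  match l with
  | none => exact Or.inr (List.cons_ne_nil _ _)
  | some e =>
    change X = .CF ∨ mapNT some (H.out e) ≠ []
    rw [Ne, mapNT_eq_nil]
    exact hX e

/-- The step relation of the simulating programmed grammar. -/
def ProgrammedStep (c d : Form T (Option H.Slot) × Option H.Edge) : Prop :=
  (H.programmedRule c.2).Rewrites c.1 d.1 ∧ d.2 ∈ H.programmedSuccess c.2

theorem toProgrammed_step_iff {c d} : H.toProgrammed.Step c d ↔ H.ProgrammedStep c d :=
  ⟨fun h => h.elim id fun h => h.2.2.elim, Or.inl⟩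

variable {H}

/-- In the start state the rewritten occurrence is the only nonterminal, so the context does not
notice that the start symbol is special. -/
theorem mapNT_rename_src {e : H.Edge} {u v : Form T H.Slot}
    (h : H.Reach (H.src e, u ++ [.nonterminal (H.slot e)] ++ v)) :
    mapNT (H.rename (H.src e)) u = mapNT some u ∧ mapNT (H.rename (H.src e)) v = mapNT some v := by
  by_cases hs : H.src e = H.start
  · have := h.fits
    rw [hs, H.used_start] at this
    have := congrArg Multiset.card this
    have hn : nts u = [] ∧ nts v = [] := by
      simp only [Multiset.coe_card, nts_append, List.length_append, nts_nonterminal_cons,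
        nts_nil, List.length_singleton, Finset.singleton_val, Multiset.card_singleton] at this
      constructor <;> rw [← List.length_eq_zero_iff] <;> omega
    constructor <;> refine mapNT_congr fun A hA => ?_ <;> simp [hn] at hA
  · have : H.rename (H.src e) = some := by funext i; simp [rename, hs]
    simp [this]

theorem programmedStep_of_edge {e : H.Edge} {u v : Form T H.Slot}
    (h : H.Reach (H.src e, u ++ [.nonterminal (H.slot e)] ++ v)) {l : Option H.Edge}
    (hl : ∀ e', l = some e' → H.src e' = H.tgt e) :
    H.ProgrammedStep (mapNT (H.rename (H.src e)) (u ++ [.nonterminal (H.slot e)] ++ v), some e)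
      (mapNT (H.rename (H.tgt e)) (u ++ H.out e ++ v), l) := by
  refine ⟨ContextFreeRule.rewrites_iff.2
    ⟨mapNT (H.rename (H.src e)) u, mapNT (H.rename (H.src e)) v, ?_, ?_⟩, hl⟩
  · simp [programmedRule]
  · obtain ⟨hu, hv⟩ := mapNT_rename_src h
    simp [programmedRule, rename_tgt, hu, hv]

/-- The label is chosen one step before it is used, so the induction must allow every label that
fits the current state. The label `none` always fits and lets the derivation stop even where no edge
leaves the state. -/
theorem Reach.programmed {a : H.State × Form T H.Slot} (h : H.Reach a) :
    ∀ l : Option H.Edge, (∀ e, l = some e → H.src e = a.1) → ∃ r₁,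
      ReflTransGen (fun c d => H.ProgrammedStep c d ∧ ntCount d.1 ≤ m)
        ([.nonterminal none], r₁) (mapNT (H.rename a.1) a.2, l) := by
  induction h with
  | refl =>
    intro l _
    have : mapNT (H.rename H.init.1) H.init.2 = [.nonterminal none] := by simp [init, rename]
    exact ⟨l, by rw [this]⟩
  | tail h hs ih =>
    obtain ⟨e, u, v, rfl, rfl⟩ := hs
    have h : H.Reach _ := h
    intro l hl
    obtain ⟨r₁, hr⟩ := ih (some e) (by simp)
    refine ⟨r₁, hr.tail ⟨programmedStep_of_edge h hl, ?_⟩⟩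
    simpa only [ntCount_eq_length, nts_mapNT, List.length_map] using h.step.ntCount_le

/-- A programmed derivation may begin with any label, so label and state may disagree at the start.
This does no harm: the start form is the private nonterminal `none`, which only edges leaving the
start state can rewrite, while the stopping label has no successor. -/
theorem programmed_sound {w : List T} {r₁ r₂ : Option H.Edge}
    (hr : ReflTransGen H.ProgrammedStep ([.nonterminal none], r₁) (ofWord _ w, r₂)) :
    w ∈ H.language := by
  let I : Form T (Option H.Slot) × Option H.Edge → Prop := fun c => ∃ q x, H.Reach (q, x) ∧
    c.1 = mapNT (H.rename q) x ∧ ∀ e : H.Edge, c.2 = some e → H.src e = q ∨ q = H.start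
  have hI : ∀ c d, I c → H.ProgrammedStep c d → I d := by
    rintro ⟨c, l⟩ ⟨d, l'⟩ ⟨q, x, hq, hx, hqe⟩ ⟨hrw, hl⟩
    match l with
    | none => exact hl.elim
    | some e =>
    obtain ⟨u', v', hc, hd⟩ := ContextFreeRule.rewrites_iff.1 hrw
    dsimp only at hc hx hqe hd hl
    rw [hx] at hc
    obtain ⟨u, A, v, rfl, rfl, hA, rfl⟩ := mapNT_eq_append_nonterminal hc
    change H.rename q A = H.rename (H.src e) (H.slot e) at hA
    have hsq : H.src e = q := by
      rcases hqe e rfl with h | rfl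
      · exact h
      · by_contra hne
        simp [rename, hne] at hA
    subst hsq
    have hAe : A = H.slot e := by
      by_cases hs : H.src e = H.start
      · have h₁ : A ∈ H.used (H.src e) := hq.mem_nts_iff.1 (by simp)
        have h₂ := H.slot_mem e
        rw [hs, H.used_start, Finset.mem_singleton] at h₁ h₂
        rw [h₁, h₂]
      · simpa [rename, hs] using hA
    subst hAe
    refine ⟨_, _, hq.step, ?_, fun e' he' => Or.inl (hl e' he')⟩
    obtain ⟨hu, hv⟩ := mapNT_rename_src hq
    simp only [hd, hu, hv, rename_tgt, mapNT_append, programmedRule]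
  obtain ⟨q, x, hq, hx, -⟩ := reflTransGen_invariant hI hr
    ⟨H.start, [.nonterminal H.startSlot], .refl, by simp [rename], by simp⟩
  obtain ⟨w', rfl⟩ := exists_ofWord_of_nts_eq_nil (x := x) (by simpa using congrArg nts hx.symm)
  rw [mapNT_ofWord] at hx
  obtain rfl := ofWord_injective hx
  exact ⟨q, hq⟩

/-- The language of a slot system is generated by a programmed grammar of bounded index. -/
theorem mem_programmedFamily (H : SlotSystem T m) (hm : 1 ≤ m) {X : RuleType}
    (hX : H.Allowed X) {L : Language T} (hL : SameLanguage H.language L) :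
    L ∈ programmedFamily T X m := by
  have hsound : ∀ w n, H.toProgrammed.DerivesWord w n → w ∈ H.language := fun w n hn => by
    obtain ⟨r₁, r₂, hr⟩ := H.toProgrammed.exists_derivesWord_iff.1 ⟨n, hn⟩
    exact programmed_sound (ReflTransGen.mono (fun _ _ => H.toProgrammed_step_iff.1) _ _ hr)
  have hcomplete : ∀ w ∈ H.language, ∃ n ≤ m, H.toProgrammed.DerivesWord w n := by
    rintro w ⟨q, hq⟩
    obtain ⟨r₁, hr⟩ := hq.programmed none (by simp)
    rw [mapNT_ofWord] at hr
    exact H.toProgrammed.exists_derivesWord_le_iff.2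
      ⟨hm, r₁, none, ReflTransGen.mono (fun _ _ h => ⟨H.toProgrammed_step_iff.2 h.1, h.2⟩) _ _ hr⟩
  refine mem_familyOfIndex_iff.2 ⟨H.toProgrammed, H.toProgrammed_mem hX, fun w hw => ?_,
    fun w ⟨n, hn⟩ => hcomplete w (hsound w n hn)⟩
  rw [← hL w hw]
  exact ⟨fun ⟨n, hn⟩ => hsound w n hn, fun h => let ⟨n, _, hn⟩ := hcomplete w h; ⟨n, hn⟩⟩

end SlotSystem

/-! ### Grammars with a finite control that sees which nonterminals are present -/

/-- A context-free grammar with a finite control. The control may test the set of the nonterminals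
that occur in the sentential form before a rule is applied. -/
structure ControlledGrammar (T : Type u) where
  NT : Type u
  finite_NT : Finite NT
  startNT : NT
  Control : Type u
  finite_Control : Finite Control
  rules : Set (ContextFreeRule T NT)
  finite_rules : rules.Finite
  init : Set Control
  final : Set Control
  next : Set NT → Control → ContextFreeRule T NT → Control → Prop

namespace ControlledGrammar

variable {T : Type u} (G : ControlledGrammar T)

/-- A step applies a rule and changes the control state. -/
def Step (a b : Form T G.NT × G.Control) : Prop :=
  ∃ r ∈ G.rules, r.Rewrites a.1 b.1 ∧ G.next {A | A ∈ nts a.1} a.2 r b.2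

/-- The slots that hold a nonterminal. -/
noncomputable def occupied {N : Type u} {m : ℕ} (σ : ULift.{u} (Fin m) → Option N) :
    Finset (ULift.{u} (Fin m)) :=
  Finset.univ.filter fun i => (σ i).isSome

@[simp] theorem mem_occupied {N : Type u} {m : ℕ} {σ : ULift.{u} (Fin m) → Option N}
    {i : ULift.{u} (Fin m)} : i ∈ occupied σ ↔ (σ i).isSome := by simp [occupied]

/-- The control states that a state of the slot system may stand for. -/
def current : Option (G.Control × Bool) → Set G.Control
  | none => G.init
  | some c => {c.1}

/-- The parity bit alternates. -/
def nextBit : Option (G.Control × Bool) → Bool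
  | none => true
  | some c => !c.2

/-- The states of the slot system: the nonterminals in the slots, the control state (if the
derivation has begun), and a parity bit. -/
abbrev SlotState (m : ℕ) : Type u :=
  (ULift.{u} (Fin m) → Option G.NT) × Option (G.Control × Bool)

/-- The edges of the slot system. -/
structure IsEdge {m : ℕ} (q q' : G.SlotState m) (j : ULift.{u} (Fin m))
    (z : Form T (ULift.{u} (Fin m))) : Prop where
  balance : (occupied q'.1).val + {j} = (occupied q.1).val + (nts z : Multiset _)
  keep : ∀ i ∈ occupied q.1, i ≠ j → q'.1 i = q.1 i
  -- A slot system accepts in every state, so acceptance is built into the edges: an edge that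
  -- empties all slots must reach a final control state.
  exists_rule : ∃ r ∈ G.rules, ∃ c ∈ G.current q.2, ∃ c', q.1 j = some r.input ∧
    mapNT q'.1 z = mapNT some r.output ∧ G.next {A | ∃ i, q.1 i = some A} c r c' ∧
    q'.2 = some (c', G.nextBit q.2) ∧ (occupied q'.1 = ∅ → c' ∈ G.final)

/-- Only `z` ranges over an infinite type, and it is as long as the right-hand side of one of
finitely many rules. Here the terminal alphabet has to be finite. -/
theorem finite_edges [Finite T] (m : ℕ) :
    {p : G.SlotState m × G.SlotState m × ULift.{u} (Fin m) × Form T (ULift.{u} (Fin m)) |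
      G.IsEdge p.1 p.2.1 p.2.2.1 p.2.2.2}.Finite := by
  have := G.finite_NT
  have := G.finite_Control
  have : Finite (Symbol T (ULift.{u} (Fin m))) := by
    have := Fintype.ofFinite T
    infer_instance
  obtain ⟨B, hB⟩ := (G.finite_rules.image fun r => r.output.length).bddAbove
  refine (Set.finite_univ.prod (Set.finite_univ.prod (Set.finite_univ.prod
    (List.finite_length_le (Symbol T (ULift.{u} (Fin m))) B)))).subset ?_
  rintro ⟨q, q', j, z⟩ h
  obtain ⟨r, hr, -, -, -, -, hz, -⟩ := h.exists_rule
  refine ⟨trivial, trivial, trivial, ?_⟩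
  have := congrArg List.length hz
  simp only [length_mapNT] at this
  exact this.le.trans (hB ⟨r, hr, rfl⟩)

/-- The slot system of a controlled grammar. -/
noncomputable def toSlotSystem [Finite T] {m : ℕ} (hm : 1 ≤ m) : SlotSystem T m where
  State := G.SlotState m
  finite_State := by have := G.finite_NT; have := G.finite_Control; infer_instance
  Slot := ULift.{u} (Fin m)
  finite_Slot := inferInstance
  Edge := {p : G.SlotState m × G.SlotState m × ULift.{u} (Fin m) × Form T (ULift.{u} (Fin m)) //
      G.IsEdge p.1 p.2.1 p.2.2.1 p.2.2.2}
  finite_Edge := (G.finite_edges m).to_subtype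
  src e := e.1.1
  tgt e := e.1.2.1
  slot e := e.1.2.2.1
  out e := e.1.2.2.2
  -- The control component `none` postpones the choice of the initial control state to the first
  -- edge.
  start := (fun i => if i = ⟨⟨0, hm⟩⟩ then some G.startNT else none, none)
  startSlot := ⟨⟨0, hm⟩⟩
  used q := occupied q.1
  used_start := by
    ext i
    simp only [mem_occupied, Finset.mem_singleton]
    split <;> simp [*]
  card_used q := (Finset.card_le_univ _).trans (by simp)
  -- The parity bit exists only for this: it changes along every edge, so source and target differ.
  src_ne_tgt e h := by
    obtain ⟨r, -, c, -, c', -, -, -, h', -⟩ := e.2.exists_rule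
    rw [← h] at h'
    rw [h'] at h'
    simp [nextBit] at h'
  tgt_ne_start e h := by
    obtain ⟨r, -, c, -, c', -, -, -, h', -⟩ := e.2.exists_rule
    rw [h] at h'
    simp at h'
  slot_mem e := by
    obtain ⟨r, -, c, -, c', h', -⟩ := e.2.exists_rule
    simp [h']
  balance e := e.2.balance

theorem toSlotSystem_allowed [Finite T] {m : ℕ} (hm : 1 ≤ m) {X : RuleType}
    (hX : ∀ r ∈ G.rules, X.Allows r) : (G.toSlotSystem hm).Allowed X := by
  intro e
  obtain ⟨r, hr, -, -, -, -, hz, -⟩ := e.2.exists_rule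
  refine (RuleType.allows_iff.1 (hX r hr)).imp_right fun h h' => h ?_
  change e.1.2.2.2 = [] at h'
  rw [h'] at hz
  exact mapNT_eq_nil.1 hz.symm

/-! ### Derivations of a controlled grammar versus paths of its slot system -/

variable {G}

/-- Every occupied slot occurs in the form, so the test made by the control depends on the state
alone. -/
theorem setOf_mem_nts {m : ℕ} {σ : ULift.{u} (Fin m) → Option G.NT}
    {x : Form T (ULift.{u} (Fin m))} {X : Form T G.NT}
    (hx : ∀ i, i ∈ nts x ↔ i ∈ occupied σ) (h : mapNT σ x = mapNT some X) :
    {A | ∃ i, σ i = some A} = {A | A ∈ nts X} := by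
  have h := congrArg nts h
  simp only [nts_mapNT] at h
  ext A
  constructor
  · rintro ⟨i, hi⟩
    have : some A ∈ (nts x).map σ := List.mem_map.2 ⟨i, (hx i).2 (by simp [hi]), hi⟩
    rw [h] at this
    simpa using this
  · intro hA
    have : some A ∈ (nts X).map some := List.mem_map_of_mem hA
    rw [← h] at this
    obtain ⟨i, -, hi⟩ := List.mem_map.1 this
    exact ⟨i, hi⟩

theorem mem_nts_iff_of_fits {m : ℕ} {σ : ULift.{u} (Fin m) → Option G.NT}
    {x : Form T (ULift.{u} (Fin m))} (hfit : (nts x : Multiset _) = (occupied σ).val) {i} :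
    i ∈ nts x ↔ i ∈ occupied σ := by
  rw [← Multiset.mem_coe, hfit, Finset.mem_val]

/-- The nonterminals of a form can be put into pairwise different given slots. -/
theorem exists_mapNT_eq {N I : Type u} [DecidableEq I] (X : Form T N) {l : List I}
    (hl : l.Nodup) (hlen : l.length = ntCount X) :
    ∃ z : Form T I, nts z = l ∧ ∃ τ : I → Option N, mapNT τ z = mapNT some X := by
  rw [ntCount_eq_length] at hlen
  induction X generalizing l with
  | nil =>
    exact ⟨[], (List.length_eq_zero_iff.1 (by simpa using hlen)).symm, fun _ => none, rfl⟩
  | cons s X ih =>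
    cases s with
    | terminal a =>
      obtain ⟨z, hz, τ, hτ⟩ := ih hl hlen
      exact ⟨.terminal a :: z, hz, τ, by simp [hτ]⟩
    | nonterminal A =>
      match l with
      | [] => simp at hlen
      | i :: l =>
      rw [List.nodup_cons] at hl
      obtain ⟨z, hz, τ, hτ⟩ := ih hl.2 (by simpa using hlen)
      refine ⟨.nonterminal i :: z, by simp [hz], Function.update τ i (some A), ?_⟩
      simp only [mapNT_nonterminal_cons, Function.update_self, List.cons.injEq, true_and]
      rw [← hτ]
      refine mapNT_congr fun k hk => Function.update_of_ne ?_ _ _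
      rintro rfl
      exact hl.1 (hz ▸ hk)

/-- The new nonterminals go into any slots not held by the context. There are enough of them because
the resulting form has at most `m` nonterminals. -/
theorem exists_isEdge {m : ℕ} {q : G.SlotState m} {u v : Form T (ULift.{u} (Fin m))}
    {j : ULift.{u} (Fin m)} {U V : Form T G.NT} {r : ContextFreeRule T G.NT} {c c' : G.Control}
    (hfit : (nts (u ++ [.nonterminal j] ++ v) : Multiset _) = (occupied q.1).val)
    (hmap : mapNT q.1 (u ++ [.nonterminal j] ++ v) = mapNT some (U ++ [.nonterminal r.input] ++ V))
    (hj : q.1 j = some r.input)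
    (hcount : ntCount (U ++ r.output ++ V) ≤ m) (hr : r ∈ G.rules) (hc : c ∈ G.current q.2)
    (hn : G.next {A | A ∈ nts (U ++ [.nonterminal r.input] ++ V)} c r c')
    (hfin : nts (U ++ r.output ++ V) = [] → c' ∈ G.final) :
    ∃ q' z, G.IsEdge q q' j z ∧ mapNT q'.1 z = mapNT some r.output ∧ c' ∈ G.current q'.2 := by
  classical
  have hjm : j ∈ occupied q.1 := by simp [hj]
  have hlen := congrArg (fun x => (nts x).length) hmap
  have hcard : (occupied q.1).card = (nts (u ++ [.nonterminal j] ++ v)).length := by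
    rw [← Multiset.coe_card, hfit]; rfl
  rw [ntCount_eq_length] at hcount
  simp only [nts_mapNT, nts_append, nts_nonterminal_cons, nts_nil, List.length_map,
    List.length_append, List.length_singleton] at hlen hcount hcard
  have hfree : (nts r.output).length ≤ ((occupied q.1).erase j)ᶜ.card := by
    rw [Finset.card_compl, Finset.card_erase_of_mem hjm, hcard]
    simp only [Fintype.card_ulift, Fintype.card_fin]
    omega
  obtain ⟨s, hs, hscard⟩ := Finset.exists_subset_card_eq hfree
  obtain ⟨z, hz, τ, hτ⟩ := exists_mapNT_eq r.output s.nodup_toList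
    (by rw [Finset.length_toList, hscard, ntCount_eq_length])
  have hτs : ∀ i ∈ s, (τ i).isSome := by
    intro i hi
    have h : τ i ∈ (nts z).map τ := List.mem_map_of_mem (by simpa [hz] using hi)
    rw [← nts_mapNT, hτ, nts_mapNT] at h
    obtain ⟨A, -, hA⟩ := List.mem_map.1 h
    simp [← hA]
  -- The slot `j` is free again and may belong to `s`, so membership in `s` is tested first.
  let σ' : ULift.{u} (Fin m) → Option G.NT := fun i =>
    if i ∈ s then τ i else if i = j then none else q.1 i
  have hσz : mapNT σ' z = mapNT some r.output := by
    rw [← hτ]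
    refine mapNT_congr fun i hi => ?_
    rw [hz, Finset.mem_toList] at hi
    simp [σ', hi]
  have hocc : occupied σ' = (occupied q.1).erase j ∪ s := by
    ext i
    by_cases his : i ∈ s
    · simp [σ', his, hτs i his]
    · by_cases hij : i = j
      · subst hij
        simp [σ', his]
      · simp [σ', his, hij]
  have hdisj : Disjoint ((occupied q.1).erase j) s :=
    Finset.disjoint_left.2 fun i hi his => Finset.mem_compl.1 (hs his) hi
  have hbal : (occupied σ').val + {j} = (occupied q.1).val + (nts z : Multiset _) := by
    rw [hocc, ← Finset.disjUnion_eq_union _ _ hdisj, Finset.disjUnion_val, Finset.erase_val, hz,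
      Finset.coe_toList, add_right_comm]
    congr 1
    rw [add_comm, Multiset.singleton_add, Multiset.cons_erase hjm]
  have hkeep : ∀ i ∈ occupied q.1, i ≠ j → σ' i = q.1 i := by
    intro i hi hij
    have : i ∉ s := fun his => Finset.mem_compl.1 (hs his) (Finset.mem_erase.2 ⟨hij, hi⟩)
    simp [σ', this, hij]
  refine ⟨(σ', some (c', G.nextBit q.2)), z, ⟨hbal, hkeep, r, hr, c, hc, c', hj, hσz, ?_, rfl, ?_⟩,
    hσz, rfl⟩
  · rw [setOf_mem_nts (fun _ => mem_nts_iff_of_fits hfit) hmap]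
    exact hn
  · intro h0
    refine hfin (List.length_eq_zero_iff.1 ?_)
    have h := congrArg Multiset.card hbal
    change (occupied σ' = ∅) at h0
    simp only [h0, Multiset.card_add, Multiset.card_singleton, Finset.empty_val,
      Multiset.card_zero, Finset.card_val, Multiset.coe_card, hz, Finset.length_toList] at h
    simp only [nts_append, List.length_append]
    omega

theorem IsEdge.mapNT_eq {m : ℕ} {q q' : G.SlotState m} {j : ULift.{u} (Fin m)}
    {u z v : Form T (ULift.{u} (Fin m))} (he : G.IsEdge q q' j z)
    (hfit : (nts (u ++ [.nonterminal j] ++ v) : Multiset _) = (occupied q.1).val) :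
    mapNT q'.1 u = mapNT q.1 u ∧ mapNT q'.1 v = mapNT q.1 v := by
  have hnd : (nts (u ++ [.nonterminal j] ++ v)).Nodup := by
    rw [← Multiset.coe_nodup, hfit]; exact Finset.nodup _
  have hkeep : ∀ i, i ∈ nts u ∨ i ∈ nts v → q'.1 i = q.1 i := by
    intro i hi
    refine he.keep i ((mem_nts_iff_of_fits hfit).1 ?_) ?_
    · simp only [nts_append, List.mem_append]; tauto
    · rintro rfl
      simp only [nts_append, nts_nonterminal_cons, nts_nil] at hnd
      rw [List.nodup_append, List.nodup_append] at hnd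
      rcases hi with hi | hi
      · exact hnd.1.2.2 _ hi _ (by simp) rfl
      · exact hnd.2.2 _ (by simp) _ hi rfl
  exact ⟨mapNT_congr fun i hi => hkeep i (.inl hi), mapNT_congr fun i hi => hkeep i (.inr hi)⟩

variable [Finite T] {m : ℕ} {hm : 1 ≤ m}

variable (G hm) in
/-- Reachability in the slot system. -/
def SlotReach (q : G.SlotState m) (x : Form T (ULift.{u} (Fin m))) : Prop :=
  (G.toSlotSystem hm).Reach (q, x)

variable (G hm) in
/-- The content of the slots at the beginning. -/
def initialSlots (i : ULift.{u} (Fin m)) : Option G.NT :=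
  if i = ⟨⟨0, hm⟩⟩ then some G.startNT else none

theorem SlotReach.fits {q : G.SlotState m} {x : Form T (ULift.{u} (Fin m))}
    (h : G.SlotReach hm q x) : (nts x : Multiset _) = (occupied q.1).val :=
  SlotSystem.Reach.fits h

theorem SlotReach.init : G.SlotReach hm (G.initialSlots hm, none) [.nonterminal ⟨⟨0, hm⟩⟩] :=
  ReflTransGen.refl

theorem SlotReach.step {q q' : G.SlotState m} {j : ULift.{u} (Fin m)}
    {u z v : Form T (ULift.{u} (Fin m))} (he : G.IsEdge q q' j z)
    (h : G.SlotReach hm q (u ++ [.nonterminal j] ++ v)) : G.SlotReach hm q' (u ++ z ++ v) :=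
  SlotSystem.Reach.step (H := G.toSlotSystem hm) (e := ⟨(q, q', j, z), he⟩) h

@[elab_as_elim]
theorem SlotReach.induction {P : G.SlotState m → Form T (ULift.{u} (Fin m)) → Prop}
    (init : P (G.initialSlots hm, none) [.nonterminal ⟨⟨0, hm⟩⟩])
    (step : ∀ q q' j z u v, G.IsEdge q q' j z → G.SlotReach hm q (u ++ [.nonterminal j] ++ v) →
      P q (u ++ [.nonterminal j] ++ v) → P q' (u ++ z ++ v))
    {q : G.SlotState m} {x : Form T (ULift.{u} (Fin m))} (h : G.SlotReach hm q x) : P q x := by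
  suffices ∀ a, (G.toSlotSystem hm).Reach a → P a.1 a.2 from this _ h
  intro a ha
  induction ha with
  | refl => exact init
  | tail h hs ih =>
    obtain ⟨⟨⟨q, q', j, z⟩, he⟩, u, v, rfl, rfl⟩ := hs
    exact step q q' j z u v he h ih

/-- Reading off the slot contents projects every path to a derivation. In the start state all
initial controls are still possible, hence the quantifier over `G.current`. -/
theorem SlotReach.exists_path {q : G.SlotState m} {x : Form T (ULift.{u} (Fin m))}
    (h : G.SlotReach hm q x) :
    ∃ X, mapNT q.1 x = mapNT some X ∧ ∀ c ∈ G.current q.2, ∃ c₀ ∈ G.init,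
      ReflTransGen G.Step ([.nonterminal G.startNT], c₀) (X, c) ∧
      (occupied q.1 = ∅ → c ∈ G.final) := by
  refine SlotReach.induction ?_ (fun q q' j z u v he h ih => ?_) h
  · refine ⟨[.nonterminal G.startNT], by simp [initialSlots], fun c hc => ⟨c, hc, .refl, fun h => ?_⟩⟩
    have := mem_occupied (σ := G.initialSlots hm) (i := ⟨⟨0, hm⟩⟩)
    rw [h] at this
    simp [initialSlots] at this
  · obtain ⟨X, hX, hc⟩ := ih
    obtain ⟨r, hr, c, hcc, c', hj, hz, hn, hq', hfin⟩ := he.exists_rule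
    have hset := setOf_mem_nts (fun _ => mem_nts_iff_of_fits h.fits) hX
    obtain ⟨c₀, hc₀, hpath, -⟩ := hc c hcc
    simp only [mapNT_append, mapNT_nonterminal_cons, mapNT_nil, hj] at hX
    obtain ⟨U, A, V, rfl, hU, hA, hV⟩ := mapNT_eq_append_nonterminal hX.symm
    obtain rfl : A = r.input := by simpa using hA
    refine ⟨U ++ r.output ++ V, ?_, ?_⟩
    · obtain ⟨hu, hv⟩ := he.mapNT_eq h.fits
      simp only [mapNT_append, hz, hU, hV, hu, hv]
    · rw [hq']
      rintro _ rfl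
      refine ⟨c₀, hc₀, hpath.tail ⟨r, hr, ContextFreeRule.rewrites_iff.2 ⟨U, V, rfl, rfl⟩, ?_⟩, hfin⟩
      rw [← hset]
      exact hn

/-- `G.init` might be empty, so at the start there need not be a control state; but then a
nonterminal is still present. -/
theorem SlotReach.eq_init_or {q : G.SlotState m} {x : Form T (ULift.{u} (Fin m))}
    (h : G.SlotReach hm q x) : nts x ≠ [] ∨ ∃ c, c ∈ G.current q.2 := by
  refine SlotReach.induction (.inl (by simp)) (fun q q' j z u v he h ih => ?_) h
  obtain ⟨r, hr, c, hcc, c', hj, hz, hn, hq', hfin⟩ := he.exists_rule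
  exact .inr ⟨c', by rw [hq']; rfl⟩

theorem path_of_mem_language {w : List T} (h : w ∈ (G.toSlotSystem hm).language) :
    ∃ c₀ ∈ G.init, ∃ c ∈ G.final,
      ReflTransGen G.Step ([.nonterminal G.startNT], c₀) (ofWord G.NT w, c) := by
  obtain ⟨q, hq⟩ := h
  have hq : G.SlotReach hm q (ofWord _ w) := hq
  obtain ⟨X, hX, hpath⟩ := hq.exists_path
  rw [mapNT_ofWord, ← mapNT_ofWord some] at hX
  obtain rfl := mapNT_injective (Option.some_injective _) hX
  obtain ⟨c, hc⟩ := hq.eq_init_or.resolve_left (by simp)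
  obtain ⟨c₀, hc₀, hr, hfin⟩ := hpath c hc
  refine ⟨c₀, hc₀, c, hfin ?_, hr⟩
  rw [← Finset.val_eq_zero, ← hq.fits, nts_ofWord]
  rfl

theorem exists_slotReach {c₀ : G.Control} (hc₀ : c₀ ∈ G.init) {a : Form T G.NT × G.Control}
    (h : ReflTransGen (fun a b => G.Step a b ∧ ntCount b.1 ≤ m)
      ([.nonterminal G.startNT], c₀) a) (hfin : nts a.1 = [] → a.2 ∈ G.final) :
    ∃ q x, G.SlotReach hm q x ∧ mapNT q.1 x = mapNT some a.1 ∧ a.2 ∈ G.current q.2 := by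
  induction h with
  | refl => exact ⟨_, _, .init, by simp [initialSlots], hc₀⟩
  | tail h hs ih =>
    obtain ⟨⟨r, hr, hrw, hn⟩, hcount⟩ := hs
    rename_i b b'
    obtain ⟨X, c⟩ := b
    obtain ⟨X', c'⟩ := b'
    obtain ⟨U, V, hX, hX'⟩ := ContextFreeRule.rewrites_iff.1 hrw
    dsimp only at hX hX'
    subst hX hX'
    -- A form about to be rewritten contains a nonterminal, so the finality condition on it is
    -- vacuous.
    obtain ⟨q, x, hq, hmap, hc⟩ := ih (by simp)
    have hmap' := hmap
    simp only [mapNT_append, mapNT_nonterminal_cons, mapNT_nil] at hmap'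
    obtain ⟨u, j, v, rfl, hu, hj, hv⟩ := mapNT_eq_append_nonterminal hmap'
    obtain ⟨q', z, he, hz, hc'⟩ := exists_isEdge hq.fits hmap hj hcount hr hc hn hfin
    refine ⟨q', _, hq.step he, ?_, hc'⟩
    obtain ⟨hu', hv'⟩ := he.mapNT_eq hq.fits
    simp only [mapNT_append, hu', hv', hu, hv, hz]

theorem mem_language_of_path {w : List T} {c₀ c : G.Control} (hc₀ : c₀ ∈ G.init)
    (hc : c ∈ G.final) (h : ReflTransGen (fun a b => G.Step a b ∧ ntCount b.1 ≤ m)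
      ([.nonterminal G.startNT], c₀) (ofWord G.NT w, c)) :
    w ∈ (G.toSlotSystem hm).language := by
  obtain ⟨q, x, hq, hx, -⟩ := exists_slotReach (hm := hm) hc₀ h fun _ => hc
  obtain ⟨w', rfl⟩ := exists_ofWord_of_nts_eq_nil (x := x) (by simpa using congrArg nts hx)
  rw [mapNT_ofWord, mapNT_ofWord] at hx
  obtain rfl := ofWord_injective hx
  exact ⟨q, hq⟩

end ControlledGrammar

/-- Slot paths project to derivations, and derivations of index at most `m` lift to slot paths.
Derivations of larger index are lost, which is harmless when each word of `L` also has a bounded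
one. -/
theorem ControlledGrammar.exists_slotSystem {T : Type u} [Finite T] (G : ControlledGrammar T)
    {m : ℕ} (hm : 1 ≤ m) {X : RuleType} (hX : ∀ r ∈ G.rules, X.Allows r) {L : Language T}
    (hsound : ∀ w, ∀ c₀ ∈ G.init, ∀ c ∈ G.final,
      ReflTransGen G.Step ([.nonterminal G.startNT], c₀) (ofWord G.NT w, c) → w ∈ L)
    (hcomplete : ∀ w ∈ L, ∃ c₀ ∈ G.init, ∃ c ∈ G.final,
      ReflTransGen (fun a b => G.Step a b ∧ ntCount b.1 ≤ m)
        ([.nonterminal G.startNT], c₀) (ofWord G.NT w, c)) :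
    ∃ H : SlotSystem T m, H.Allowed X ∧ H.language = L := by
  refine ⟨G.toSlotSystem hm, G.toSlotSystem_allowed hm hX, Set.ext fun w => ⟨fun hw => ?_, fun hw => ?_⟩⟩
  · obtain ⟨c₀, hc₀, c, hc, h⟩ := path_of_mem_language hw
    exact hsound w c₀ hc₀ c hc h
  · obtain ⟨c₀, hc₀, c, hc, h⟩ := hcomplete w hw
    exact mem_language_of_path hc₀ hc h

/-! ### Programmed grammars as controlled grammars -/

namespace ProgrammedGrammar

variable {T : Type u} (G : ProgrammedGrammar T)

/-- A programmed grammar without appearance checking as a controlled grammar. -/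
def toControlled : ControlledGrammar T where
  NT := G.NT
  finite_NT := G.finite_NT
  startNT := G.start
  Control := G.Label
  finite_Control := G.finite_Label
  rules := Set.range G.rule
  finite_rules := have := G.finite_Label; Set.finite_range _
  init := Set.univ
  final := Set.univ
  next _ c r c' := r = G.rule c ∧ c' ∈ G.success c

theorem toControlled_step_iff (hG : ∀ r, G.failure r = ∅) {a b : Form T G.NT × G.Label} :
    G.toControlled.Step a b ↔ G.Step a b := by
  constructor
  · rintro ⟨_, -, hrw, rfl, hs⟩
    exact .inl ⟨hrw, hs⟩
  · rintro (⟨hrw, hs⟩ | ⟨-, -, hf⟩)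
    · exact ⟨_, ⟨_, rfl⟩, hrw, rfl, hs⟩
    · rw [hG] at hf
      exact hf.elim

end ProgrammedGrammar

theorem exists_slotSystem_of_mem_programmedFamily {T : Type u} [Finite T] {m : ℕ} (hm : 1 ≤ m)
    {X : RuleType} {L : Language T} (hL : L ∈ programmedFamily T X m) :
    ∃ H : SlotSystem T m, H.Allowed X ∧ SameLanguage H.language L := by
  obtain ⟨G, ⟨hX, hf⟩, hGL, hm'⟩ := mem_familyOfIndex_iff.1 hL
  obtain ⟨H, hH, hHL⟩ := G.toControlled.exists_slotSystem hm (X := X)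
    (L := generated ProgrammedGrammar.DerivesWord G) (by rintro _ ⟨r, rfl⟩; exact hX r)
    (fun w c₀ _ c _ h => G.exists_derivesWord_iff.2
      ⟨c₀, c, ReflTransGen.mono (fun _ _ => (G.toControlled_step_iff hf).1) _ _ h⟩)
    (fun w hw => by
      obtain ⟨-, c₀, c, h⟩ := G.exists_derivesWord_le_iff.1 (hm' w hw)
      exact ⟨c₀, trivial, c, trivial,
        ReflTransGen.mono (fun _ _ h => ⟨(G.toControlled_step_iff hf).2 h.1, h.2⟩) _ _ h⟩)
  exact ⟨H, hH, hHL ▸ hGL⟩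

/-! ### Hybrid systems as controlled grammars -/

/-- Step numbers beyond the bound of a mode are indistinguishable. The cap is `k + 1`, since a cap
at `k` would confuse `k` with larger numbers in the modes `= k` and `≤ k`. -/
theorem BasicMode.exists_holds_min_iff (f : BasicMode) :
    ∃ K₀, ∀ K ≥ K₀, ∀ n p, f.Holds (min n K) p ↔ f.Holds n p := by
  cases f with
  | star => exact ⟨0, fun _ _ _ _ => Iff.rfl⟩
  | t => exact ⟨0, fun _ _ _ _ => Iff.rfl⟩
  | le k => exact ⟨k + 1, fun K hK n p => by unfold Holds; omega⟩
  | eq k => exact ⟨k + 1, fun K hK n p => by unfold Holds; omega⟩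
  | ge k => exact ⟨k + 1, fun K hK n p => by unfold Holds; omega⟩

theorem Mode.exists_holds_min_iff (f : Mode) :
    ∃ K₀, ∀ K ≥ K₀, ∀ n p, f.Holds (min n K) p ↔ f.Holds n p := by
  cases f with
  | basic f => exact f.exists_holds_min_iff
  | and f g =>
    obtain ⟨K, hK⟩ := f.exists_holds_min_iff
    obtain ⟨K', hK'⟩ := g.exists_holds_min_iff
    exact ⟨max K K', fun k hk n p => and_congr (hK k (le_of_max_le_left hk) n p)
      (hK' k (le_of_max_le_right hk) n p)⟩

namespace HCDSystem

variable {T : Type u} (G : HCDSystem T)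

/-- From some number of steps on, the modes do not distinguish numbers of steps. -/
theorem exists_cap : ∃ K, ∀ i n p, (G.mode i).Holds (min n K) p ↔ (G.mode i).Holds n p := by
  choose K₀ hK₀ using fun i => (G.mode i).exists_holds_min_iff
  obtain ⟨K, hK⟩ := (Set.finite_range K₀).bddAbove
  exact ⟨K, fun i => hK₀ i K (hK ⟨i, rfl⟩)⟩

/-- No rule of the component rewrites one of the given nonterminals. -/
def Stuck (i : Fin G.degree) (S : Set G.NT) : Prop := ∀ r ∈ G.rules i, r.input ∉ S

theorem not_exists_step_iff {i : Fin G.degree} {y : Form T G.NT} :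
    (¬ ∃ z, G.Step i y z) ↔ G.Stuck i {A | A ∈ nts y} := by
  constructor
  · intro h r hr hA
    obtain ⟨p, q, rfl⟩ := exists_eq_append_of_mem_nts hA
    exact h ⟨_, r, hr, ContextFreeRule.rewrites_iff.2 ⟨p, q, rfl, rfl⟩⟩
  · rintro h ⟨z, r, hr, hrw⟩
    obtain ⟨p, q, rfl, -⟩ := ContextFreeRule.rewrites_iff.1 hrw
    exact h r hr (by simp)

/-- The control state: component `i` is working and has done `s` steps (counted up to `K`). -/
def ctl (K : ℕ) (i : Fin G.degree) (s : ℕ) : ULift.{u} (Fin G.degree × Fin (K + 1)) :=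
  ⟨(i, ⟨min s K, by omega⟩)⟩

variable {G} in
theorem ctl_eq_iff {K : ℕ} {i i' : Fin G.degree} {s s' : ℕ} :
    G.ctl K i s = G.ctl K i' s' ↔ i = i' ∧ min s K = min s' K := by
  simp [ctl]

variable {G} in
theorem ctl_succ {K : ℕ} {i i' : Fin G.degree} {s s' : ℕ} (h : G.ctl K i s = G.ctl K i' s') :
    G.ctl K i (s + 1) = G.ctl K i' (s' + 1) := by
  rw [ctl_eq_iff] at *
  omega

/-- The end of a turn, and the beginning of the next one. -/
def NextTurn (K : ℕ) (S : Set G.NT) (a b : ULift.{u} (Fin G.degree × Fin (K + 1))) : Prop :=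
  ∃ i s i', a = G.ctl K i s ∧ b = G.ctl K i' 0 ∧ (G.mode i).Holds s (G.Stuck i S)

/-- A hybrid system as a controlled grammar. -/
def toControlled (K : ℕ) : ControlledGrammar T where
  NT := G.NT
  finite_NT := G.finite_NT
  startNT := G.start
  Control := ULift.{u} (Fin G.degree × Fin (K + 1))
  finite_Control := inferInstance
  rules := ⋃ i, G.rules i
  finite_rules := Set.finite_iUnion fun i => (G.rules i).finite_toSet
  init := Set.range fun i => G.ctl K i 0
  -- Turns may have no steps, so any number of turn boundaries can pass without rewriting. They are
  -- absorbed into the next rule application or, on a terminal word, where no nonterminal is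
  -- present, into acceptance.
  final := {a | ∃ i s, ReflTransGen (G.NextTurn K ∅) a (G.ctl K i s) ∧
    (G.mode i).Holds s (G.Stuck i ∅)}
  next S a r b := ∃ i s, ReflTransGen (G.NextTurn K S) a (G.ctl K i s) ∧ r ∈ G.rules i ∧
    b = G.ctl K i (s + 1)

/-! ### Turns of a hybrid system versus control steps -/

variable {G}

theorem Derives.trans_modeStep {x y z : Form T G.NT} {D E : List (Form T G.NT)}
    {i : Fin G.degree} (h : G.Derives x D y) (h' : G.ModeStep i y E z) :
    G.Derives x (D ++ E) z := by
  induction h with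
  | single j h => exact .cons j h (.single i h')
  | cons j h _ ih => rw [List.append_assoc]; exact .cons j h (ih h')

/-- The forms at which a turn may begin. -/
def Started (G : HCDSystem T) (x : Form T G.NT) : Prop :=
  x = [.nonterminal G.start] ∨ ∃ D, G.Derives [.nonterminal G.start] D x

theorem Started.modeStep {x y : Form T G.NT} {D : List (Form T G.NT)} {i : Fin G.degree}
    (h : G.Started x) (h' : G.ModeStep i x D y) :
    ∃ E, G.Derives [.nonterminal G.start] E y := by
  rcases h with rfl | ⟨E, hE⟩
  · exact ⟨D, .single i h'⟩
  · exact ⟨_, hE.trans_modeStep h'⟩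

theorem exists_modeStep_of_iter {x y : Form T G.NT} {i : Fin G.degree} {n : ℕ}
    (h : Iter (G.Step i) n x y) (hn : (G.mode i).Holds n (G.Stuck i {A | A ∈ nts y})) :
    ∃ D, G.ModeStep i x D y := by
  obtain ⟨D, hc, hl, rfl, -⟩ := (Iter.exists_isChain (P := fun _ => True)).1
    (h.mono fun a b h => ⟨h, trivial⟩)
  exact ⟨D, hc, hl, by rwa [not_exists_step_iff]⟩

/-- The invariant: the control state describes the turn that is going on. -/
def InTurn (G : HCDSystem T) (K : ℕ)
    (a : Form T G.NT × ULift.{u} (Fin G.degree × Fin (K + 1))) : Prop :=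
  ∃ i n x₀, a.2 = G.ctl K i n ∧ G.Started x₀ ∧ Iter (G.Step i) n x₀ a.1

theorem InTurn.exists_derives {K : ℕ} {x : Form T G.NT} {i : Fin G.degree} {s : ℕ}
    (hK : ∀ i n p, (G.mode i).Holds (min n K) p ↔ (G.mode i).Holds n p)
    (h : G.InTurn K (x, G.ctl K i s)) (hs : (G.mode i).Holds s (G.Stuck i {A | A ∈ nts x})) :
    ∃ E, G.Derives [.nonterminal G.start] E x := by
  obtain ⟨i', n, x₀, hc, hx₀, hit⟩ := h
  obtain ⟨rfl, hmin⟩ := ctl_eq_iff.1 hc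
  -- The recorded number `s` and the true length `n` agree only up to the cap, which the mode does
  -- not see.
  rw [← hK, hmin, hK] at hs
  obtain ⟨D, hD⟩ := exists_modeStep_of_iter hit hs
  exact hx₀.modeStep hD

theorem InTurn.nextTurn {K : ℕ} {x : Form T G.NT}
    {a b : ULift.{u} (Fin G.degree × Fin (K + 1))}
    (hK : ∀ i n p, (G.mode i).Holds (min n K) p ↔ (G.mode i).Holds n p)
    (h : G.InTurn K (x, a)) (hab : ReflTransGen (G.NextTurn K {A | A ∈ nts x}) a b) :
    G.InTurn K (x, b) := by
  induction hab with
  | refl => exact h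
  | tail _ hbc ih =>
    obtain ⟨i, s, i', rfl, rfl, hs⟩ := hbc
    exact ⟨i', 0, x, rfl, .inr (ih.exists_derives hK hs), .zero x⟩

theorem InTurn.step {K : ℕ} {a b : Form T G.NT × ULift.{u} (Fin G.degree × Fin (K + 1))}
    (hK : ∀ i n p, (G.mode i).Holds (min n K) p ↔ (G.mode i).Holds n p)
    (h : G.InTurn K a) (hab : (G.toControlled K).Step a b) : G.InTurn K b := by
  obtain ⟨x, a⟩ := a
  obtain ⟨y, b⟩ := b
  obtain ⟨r, -, hrw, i, s, hac, hr, rfl⟩ := hab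
  obtain ⟨i', n, x₀, hc, hx₀, hit⟩ := h.nextTurn hK hac
  obtain ⟨rfl, -⟩ := ctl_eq_iff.1 hc
  exact ⟨i, n + 1, x₀, ctl_succ hc, hx₀, hit.tail ⟨r, hr, hrw⟩⟩

/-- The bounded step relation of the controlled grammar. -/
def BoundedStep (G : HCDSystem T) (K m : ℕ)
    (a b : Form T G.NT × ULift.{u} (Fin G.degree × Fin (K + 1))) : Prop :=
  (G.toControlled K).Step a b ∧ ntCount b.1 ≤ m

theorem boundedStep_of_iter {K m n : ℕ} {i : Fin G.degree} {x y : Form T G.NT}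
    (h : Iter (fun a b => G.Step i a b ∧ ntCount b ≤ m) n x y) (s : ℕ) :
    ReflTransGen (G.BoundedStep K m) (x, G.ctl K i s) (y, G.ctl K i (s + n)) := by
  induction h generalizing s with
  | zero => exact .refl
  | head hr _ ih =>
    obtain ⟨⟨r, hr, hrw⟩, hm⟩ := hr
    refine .head (b := (_, G.ctl K i (s + 1))) ⟨⟨r, ?_, hrw, i, s, .refl, hr, rfl⟩, hm⟩ ?_
    · exact Set.mem_iUnion.2 ⟨i, hr⟩
    · have := ih (s + 1)
      rwa [Nat.add_assoc, Nat.add_comm 1] at this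

theorem ModeStep.iter {m : ℕ} {i : Fin G.degree} {x y : Form T G.NT} {D : List (Form T G.NT)}
    (h : G.ModeStep i x D y) (hD : ∀ d ∈ D, ntCount d ≤ m) :
    Iter (fun a b => G.Step i a b ∧ ntCount b ≤ m) D.length x y :=
  Iter.exists_isChain.2 ⟨D, h.1, h.2.1, rfl, hD⟩

/-- A turn boundary is not a step of its own: it is merged into the first rewriting step that
follows, or into acceptance if there is none. -/
theorem exists_boundedStep_of_nextTurn {K m : ℕ} {a b : ULift.{u} (Fin G.degree × Fin (K + 1))}
    {y z : Form T G.NT} (hz : nts z = []) (hab : G.NextTurn K {A | A ∈ nts y} a b)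
    (h : ∃ c ∈ (G.toControlled K).final, ReflTransGen (G.BoundedStep K m) (y, b) (z, c)) :
    ∃ c ∈ (G.toControlled K).final, ReflTransGen (G.BoundedStep K m) (y, a) (z, c) := by
  obtain ⟨c, hc, h⟩ := h
  rcases h.cases_head with h | ⟨d, hs, h⟩
  · obtain ⟨rfl, rfl⟩ := Prod.mk.inj h
    obtain ⟨i, s, hp, hs⟩ := hc
    refine ⟨a, ⟨i, s, hp.head ?_, hs⟩, .refl⟩
    simpa [hz] using hab
  · obtain ⟨⟨r, hr, hrw, i, s, hp, hri, hd⟩, hm⟩ := hs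
    exact ⟨c, hc, .head ⟨⟨r, hr, hrw, i, s, hp.head hab, hri, hd⟩, hm⟩ h⟩

theorem Derives.exists_boundedStep {K m : ℕ} {x z : Form T G.NT} {D : List (Form T G.NT)}
    (h : G.Derives x D z) (hD : ∀ d ∈ D, ntCount d ≤ m) (hz : nts z = []) :
    ∃ i, ∃ c ∈ (G.toControlled K).final,
      ReflTransGen (G.BoundedStep K m) (x, G.ctl K i 0) (z, c) := by
  induction h with
  | @single x y D i h =>
    have hh := h.2.2
    rw [not_exists_step_iff] at hh
    refine ⟨i, _, ⟨i, D.length, ?_, ?_⟩, boundedStep_of_iter (h.iter hD) 0⟩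
    · rw [Nat.zero_add]
    · simpa [hz] using hh
  | @cons x y z D E i h _ ih =>
    obtain ⟨i', hi'⟩ := ih (fun d hd => hD d (List.mem_append_right _ hd)) hz
    have hh := h.2.2
    rw [not_exists_step_iff] at hh
    obtain ⟨c, hc, hp⟩ := exists_boundedStep_of_nextTurn hz ⟨i, D.length, i', rfl, rfl, hh⟩ hi'
    refine ⟨i, c, hc, .trans ?_ hp⟩
    have := boundedStep_of_iter (K := K) (h.iter fun d hd => hD d (List.mem_append_left _ hd)) 0
    rwa [Nat.zero_add] at this

theorem exists_slotSystem [Finite T] {m : ℕ} (hm : 1 ≤ m) {X : RuleType}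
    (hX : ∀ i, ∀ r ∈ G.rules i, X.Allows r)
    (hG : ∀ w ∈ generated HCDSystem.DerivesWord G, ∃ n ≤ m, G.DerivesWord w n) :
    ∃ H : SlotSystem T m, H.Allowed X ∧ H.language = generated HCDSystem.DerivesWord G := by
  obtain ⟨K, hK⟩ := G.exists_cap
  refine (G.toControlled K).exists_slotSystem hm ?_ ?_ ?_
  · intro r hr
    obtain ⟨i, hi⟩ := Set.mem_iUnion.1 hr
    exact hX i r hi
  · rintro w _ ⟨i₀, rfl⟩ c ⟨i, s, hcs, hs⟩ h
    have hI : G.InTurn K (ofWord G.NT w, c) :=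
      reflTransGen_invariant (I := G.InTurn K) (fun _ _ => InTurn.step hK) h
        ⟨i₀, 0, _, rfl, .inl rfl, .zero _⟩
    have he : {A | A ∈ nts (ofWord G.NT w)} = ∅ := by simp
    obtain ⟨E, hE⟩ := (hI.nextTurn hK (b := G.ctl K i s) (by rwa [he])).exists_derives hK
      (by rwa [he])
    exact ⟨_, E, hE, rfl⟩
  · intro w hw
    obtain ⟨n, hn, D, hD, rfl⟩ := hG w hw
    rw [formsIndex_le_iff] at hn
    obtain ⟨i, c, hc, h⟩ := hD.exists_boundedStep (K := K)
      (fun d hd => hn d (List.mem_cons_of_mem _ hd)) (nts_ofWord w)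
    exact ⟨_, ⟨i, rfl⟩, c, hc, h⟩

end HCDSystem

theorem exists_slotSystem_of_mem_hcdFamily {T : Type u} [Finite T] {m : ℕ} (hm : 1 ≤ m)
    {X : RuleType} {F : Set Mode} {L : Language T} (hL : L ∈ hcdFamily T X F m) :
    ∃ H : SlotSystem T m, H.Allowed X ∧ SameLanguage H.language L := by
  obtain ⟨G, ⟨hX, -⟩, hGL, hm'⟩ := mem_familyOfIndex_iff.1 hL
  obtain ⟨H, hH, hHL⟩ := G.exists_slotSystem hm hX hm'
  exact ⟨H, hH, hHL ▸ hGL⟩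

/-! ### Grammar systems given by an indexed family of rule sets -/

/-- A rewriting step by a rule of the set. -/
def RuleStep {T N : Type u} (R : Set (ContextFreeRule T N)) (x y : Form T N) : Prop :=
  ∃ r ∈ R, r.Rewrites x y

/-- A turn of a component with rules `R` in mode `f`, such that all sentential forms after the
first one have the property `P`. -/
def Turn {T N : Type u} (P : Form T N → Prop) (f : Mode) (R : Set (ContextFreeRule T N))
    (x y : Form T N) : Prop :=
  ∃ n, Iter (fun a b => RuleStep R a b ∧ P b) n x y ∧ f.Holds n (¬ ∃ z, RuleStep R y z)

namespace HCDSystem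

variable {T : Type u} {G : HCDSystem T}

theorem exists_modeStep_of_turn {P : Form T G.NT → Prop} {i : Fin G.degree} {x y : Form T G.NT}
    (h : Turn P (G.mode i) {r | r ∈ G.rules i} x y) :
    ∃ D, G.ModeStep i x D y ∧ ∀ d ∈ D, P d := by
  obtain ⟨n, h, hn⟩ := h
  obtain ⟨D, hc, hl, rfl, hD⟩ := Iter.exists_isChain.1 h
  exact ⟨D, ⟨hc, hl, hn⟩, hD⟩

theorem ModeStep.turn {P : Form T G.NT → Prop} {i : Fin G.degree} {x y : Form T G.NT}
    {D : List (Form T G.NT)} (h : G.ModeStep i x D y) (hD : ∀ d ∈ D, P d) :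
    Turn P (G.mode i) {r | r ∈ G.rules i} x y :=
  ⟨D.length, Iter.exists_isChain.2 ⟨D, h.1, h.2.1, rfl, hD⟩, h.2.2⟩

theorem Derives.turns {x y : Form T G.NT} {D : List (Form T G.NT)} (h : G.Derives x D y) :
    ReflTransGen (fun a b => ∃ i, Turn (fun _ => True) (G.mode i) {r | r ∈ G.rules i} a b) x y := by
  induction h with
  | single i h => exact .single ⟨i, h.turn fun _ _ => trivial⟩
  | cons i h _ ih => exact .head ⟨i, h.turn fun _ _ => trivial⟩ ih

theorem exists_derives_of_turns {P : Form T G.NT → Prop} {x y : Form T G.NT}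
    (h : ReflTransGen (fun a b => ∃ i, Turn P (G.mode i) {r | r ∈ G.rules i} a b) x y) :
    x = y ∨ ∃ D, G.Derives x D y ∧ ∀ d ∈ D, P d := by
  induction h with
  | refl => exact .inl rfl
  | tail _ hs ih =>
    obtain ⟨i, hi⟩ := hs
    obtain ⟨E, hE, hEP⟩ := exists_modeStep_of_turn hi
    right
    rcases ih with rfl | ⟨D, hD, hDP⟩
    · exact ⟨E, .single i hE, hEP⟩
    · refine ⟨D ++ E, hD.trans_modeStep hE, fun d hd => ?_⟩
      exact (List.mem_append.1 hd).elim (hDP d) (hEP d)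

end HCDSystem

/-- The grammar system in mode `f` whose components have the rule sets `R j`. -/
noncomputable def systemOf {T N : Type u} [Finite N] {J : Type u} [Finite J] [Nonempty J]
    (start : N) (R : J → Set (ContextFreeRule T N)) (hR : ∀ j, (R j).Finite) (f : Mode) :
    HCDSystem T where
  NT := N
  finite_NT := inferInstance
  start := start
  degree := Nat.card J
  one_le_degree := Nat.card_pos
  rules i := (hR ((Finite.equivFin J).symm i)).toFinset
  mode _ := f

/-- This isolates the bookkeeping of lists and numbered components, so that the constructions below
only have to argue about turns. -/
theorem mem_cdFamily_of_turns {T N : Type u} [Finite N] {J : Type u} [Finite J] [Nonempty J]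
    {m : ℕ} (hm : 1 ≤ m) {X : RuleType} {f : Mode} (start : N)
    (R : J → Set (ContextFreeRule T N)) (hR : ∀ j, (R j).Finite)
    (hX : ∀ j, ∀ r ∈ R j, X.Allows r) {L₀ L : Language T} (hL : SameLanguage L₀ L)
    (hsound : ∀ w, ReflTransGen (fun a b => ∃ j, Turn (fun _ => True) f (R j) a b)
      [.nonterminal start] (ofWord N w) → w ∈ L₀)
    (hcomplete : ∀ w ∈ L₀, ReflTransGen (fun a b => ∃ j, Turn (fun x => ntCount x ≤ m) f (R j) a b)
      [.nonterminal start] (ofWord N w)) :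
    L ∈ cdFamily T X f m := by
  let G := systemOf start R hR f
  have hrules : ∀ i : Fin G.degree,
      {r | r ∈ G.rules i} = R ((Finite.equivFin J).symm i) := fun i => by
    ext r
    exact Set.Finite.mem_toFinset _
  have hturn : ∀ (P : Form T N → Prop) (a b : Form T N),
      (∃ i : Fin G.degree, Turn (N := G.NT) P (G.mode i) {r | r ∈ G.rules i} a b) ↔
        ∃ j, Turn P f (R j) a b := by
    intro P a b
    have key : ∀ i : Fin G.degree, Turn (N := G.NT) P (G.mode i) {r | r ∈ G.rules i} a b ↔
        Turn P f (R ((Finite.equivFin J).symm i)) a b := fun i =>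
      (congrArg (fun S => Turn P f S a b) (hrules i)).to_iff
    constructor
    · rintro ⟨i, hi⟩
      exact ⟨_, (key i).1 hi⟩
    · rintro ⟨j, hj⟩
      refine ⟨Finite.equivFin J j, (key _).2 ?_⟩
      rwa [Equiv.symm_apply_apply]
  have hs : ∀ w n, G.DerivesWord w n → w ∈ L₀ := by
    rintro w n ⟨D, hD, -⟩
    exact hsound w (ReflTransGen.mono (fun a b => (hturn _ a b).1) _ _ hD.turns)
  have hc : ∀ w ∈ L₀, ∃ n ≤ m, G.DerivesWord w n := by
    intro w hw
    rcases HCDSystem.exists_derives_of_turns (G := G)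
      (ReflTransGen.mono (fun a b => (hturn _ a b).2) _ _ (hcomplete w hw)) with h | ⟨D, hD, hDm⟩
    · have := congrArg nts h
      simp at this
    · refine ⟨_, ?_, D, hD, rfl⟩
      rw [formsIndex_le_iff]
      intro x hx
      rcases List.mem_cons.1 hx with rfl | hx
      · exact hm
      · exact hDm x hx
  refine mem_familyOfIndex_iff.2 ⟨G, ⟨fun i r hr => ?_, fun _ => rfl⟩, fun w hw => ?_,
    fun w ⟨n, hn⟩ => hc w (hs w n hn)⟩
  · exact hX _ r ((hrules i).subset hr)
  · rw [← hL w hw]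
    exact ⟨fun ⟨n, hn⟩ => hs w n hn, fun h => let ⟨n, _, hn⟩ := hc w h; ⟨n, hn⟩⟩

/-! ### Components that apply one rule and test for forbidden nonterminals -/

section Check

variable {T N : Type u}

/-- The rule `A → z`, and rules `B → B` for all `B` that are not allowed in the result. If a turn
ends only when the component is stuck, then these rules forbid such nonterminals. -/
def checkRules (A : N) (z : Form T N) (C : N → Prop) : Set (ContextFreeRule T N) :=
  {⟨A, z⟩} ∪ {r | ∃ B, ¬ C B ∧ r = ⟨B, [.nonterminal B]⟩}

theorem finite_checkRules [Finite N] (A : N) (z : Form T N) (C : N → Prop) :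
    (checkRules A z C).Finite := by
  refine (Set.finite_singleton _).union
    ((Set.finite_range fun B : N => (⟨B, [.nonterminal B]⟩ : ContextFreeRule T N)).subset ?_)
  rintro _ ⟨B, -, rfl⟩
  exact ⟨B, rfl⟩

theorem ruleStep_checkRules {A : N} {z : Form T N} {C : N → Prop} {a b : Form T N}
    (h : RuleStep (checkRules A z C) a b) :
    b = a ∨ ∃ u v, a = u ++ [.nonterminal A] ++ v ∧ b = u ++ z ++ v := by
  obtain ⟨r, rfl | ⟨B, -, rfl⟩, hrw⟩ := h
  · obtain ⟨u, v, ha, hb⟩ := ContextFreeRule.rewrites_iff.1 hrw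
    exact .inr ⟨u, v, ha, hb⟩
  · obtain ⟨u, v, ha, hb⟩ := ContextFreeRule.rewrites_iff.1 hrw
    exact .inl (hb.trans ha.symm)

theorem not_mem_nts_of_nodup {A : N} {z u v : Form T N} (hz : A ∉ nts z)
    (hnd : (nts (u ++ [.nonterminal A] ++ v)).Nodup) : A ∉ nts (u ++ z ++ v) := by
  simp only [nts_append, nts_nonterminal_cons, nts_nil, List.nodup_append] at hnd
  simp only [nts_append, List.mem_append, not_or]
  exact ⟨⟨fun h => hnd.1.2.2 A h A (by simp) rfl, hz⟩, fun h => hnd.2.2 A (by simp) A h rfl⟩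

/-- The loop rules change nothing, and without repeated nonterminals the rule for `A` works at most
once, as `z` does not bring `A` back. Being stuck at the end excludes every nonterminal that has a
loop rule. -/
theorem Turn.of_checkRules {A : N} {z : Form T N} {C : N → Prop} {P : Form T N → Prop} {f : Mode}
    (hf : ∀ n p, f.Holds n p → p) {x y : Form T N} (hz : A ∉ nts z) (hnd : (nts x).Nodup)
    (h : Turn P f (checkRules A z C) x y) :
    y = x ∨ ∃ u v, x = u ++ [.nonterminal A] ++ v ∧ y = u ++ z ++ v ∧ ∀ B ∈ nts y, C B := by
  obtain ⟨n, h, hn⟩ := h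
  have hC : ∀ B ∈ nts y, C B := by
    intro B hB
    by_contra hCB
    obtain ⟨u, v, rfl⟩ := exists_eq_append_of_mem_nts hB
    exact hf _ _ hn ⟨_, ⟨B, [.nonterminal B]⟩, .inr ⟨B, hCB, rfl⟩,
      ContextFreeRule.rewrites_iff.2 ⟨u, v, rfl, rfl⟩⟩
  have hI : y = x ∨ ∃ u v, x = u ++ [.nonterminal A] ++ v ∧ y = u ++ z ++ v := by
    refine reflTransGen_invariant
      (I := fun y => y = x ∨ ∃ u v, x = u ++ [.nonterminal A] ++ v ∧ y = u ++ z ++ v)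
      (fun a b ha hab => ?_) h.reflTransGen (.inl rfl)
    rcases ruleStep_checkRules hab.1 with rfl | ⟨u, v, ha', rfl⟩
    · exact ha
    · rcases ha with rfl | ⟨u', v', rfl, rfl⟩
      · exact .inr ⟨u, v, ha', rfl⟩
      · have := not_mem_nts_of_nodup hz hnd
        rw [ha'] at this
        simp at this
  rcases hI with h | ⟨u, v, hx, hy⟩
  · exact .inl h
  · exact .inr ⟨u, v, hx, hy, hC⟩

/-- Because `A` itself is forbidden, `A → A` is a rule of the component; `k` idle applications of it
adjust the length of the turn to `k + 1`. -/
theorem turn_checkRules {A : N} {z : Form T N} {C : N → Prop} {P : Form T N → Prop} {f : Mode}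
    {k : ℕ} (hf : ∀ p, p → f.Holds (k + 1) p) (hA : ¬ C A) {u v : Form T N}
    (hx : P (u ++ [.nonterminal A] ++ v)) (hy : P (u ++ z ++ v))
    (hC : ∀ B ∈ nts (u ++ z ++ v), C B) :
    Turn P f (checkRules A z C) (u ++ [.nonterminal A] ++ v) (u ++ z ++ v) := by
  refine ⟨k + 1, Iter.tail (y := u ++ [.nonterminal A] ++ v) ?_
    ⟨⟨_, .inl rfl, ContextFreeRule.rewrites_iff.2 ⟨u, v, rfl, rfl⟩⟩, hy⟩, hf _ ?_⟩
  · clear hf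
    induction k with
    | zero => exact .zero _
    | succ k ih => exact .head ⟨⟨⟨A, [.nonterminal A]⟩, .inr ⟨A, hA, rfl⟩,
        ContextFreeRule.rewrites_iff.2 ⟨u, v, rfl, rfl⟩⟩, hx⟩ ih
  · rintro ⟨w, r, hr, hrw⟩
    obtain ⟨u', v', hu, -⟩ := ContextFreeRule.rewrites_iff.1 hrw
    have hmem : r.input ∈ nts (u ++ z ++ v) := by rw [hu]; simp
    rcases hr with rfl | ⟨B, hB, rfl⟩
    · exact hA (hC _ hmem)
    · exact hB (hC _ hmem)

end Check

/-! ### From slot systems to grammar systems in modes that require maximal turns -/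

namespace SlotSystem

variable {T : Type u} {m : ℕ} (H : SlotSystem T m)

/-- Slots tagged with a state or with an edge that is being traversed. -/
abbrev Tagged : Type u := (H.State ⊕ H.Edge) × H.Slot

variable {H} in
/-- Tag all slots of a form. -/
def tag (s : H.State ⊕ H.Edge) (x : Form T H.Slot) : Form T H.Tagged := mapNT (fun i => (s, i)) x

/-- A nonterminal has one of two tags, and is not the given one. -/
def TagIn (s s' : H.State ⊕ H.Edge) (A B : H.Tagged) : Prop := (B.1 = s ∨ B.1 = s') ∧ B ≠ A

open Classical in
/-- The result of moving a slot to the target of an edge. -/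
noncomputable def moved (e : H.Edge) (i : H.Slot) : Form T H.Tagged :=
  if i = H.slot e then tag (.inl (H.tgt e)) (H.out e) else [.nonterminal (.inl (H.tgt e), i)]

/-- The components: for every edge and slot, one that marks the slot with the edge, and one that
moves the slot to the target of the edge. -/
def maximalRules : Option (H.Edge × H.Slot × Bool) → Set (ContextFreeRule T H.Tagged)
  | none => ∅
  | some (e, i, false) => checkRules (.inl (H.src e), i) [.nonterminal (.inr e, i)]
      (H.TagIn (.inl (H.src e)) (.inr e) (.inl (H.src e), i))
  | some (e, i, true) => checkRules (.inr e, i) (H.moved e i)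
      (H.TagIn (.inr e) (.inl (H.tgt e)) (.inr e, i))

theorem finite_maximalRules (j : Option (H.Edge × H.Slot × Bool)) : (H.maximalRules j).Finite := by
  have := H.finite_State
  have := H.finite_Edge
  have := H.finite_Slot
  match j with
  | none => exact Set.finite_empty
  | some (e, i, false) => exact finite_checkRules _ _ _
  | some (e, i, true) => exact finite_checkRules _ _ _

theorem allows_maximalRules {X : RuleType} (hX : H.Allowed X) (j : Option (H.Edge × H.Slot × Bool)) :
    ∀ r ∈ H.maximalRules j, X.Allows r := by
  intro r hr
  rw [RuleType.allows_iff]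
  match j, hr with
  | some (e, i, false), .inl hr => obtain rfl := hr; simp
  | some (e, i, false), .inr hr => obtain ⟨B, -, rfl⟩ := hr; simp
  | some (e, i, true), .inr hr => obtain ⟨B, -, rfl⟩ := hr; simp
  | some (e, i, true), .inl hr =>
    obtain rfl := hr
    by_cases hi : i = H.slot e
    · simpa [moved, hi, tag, mapNT_eq_nil] using hX e
    · simp [moved, hi]

/-! ### Traversing an edge by tagged slots -/

variable {H}

@[simp] theorem nts_tag (s : H.State ⊕ H.Edge) (x : Form T H.Slot) :
    nts (tag s x) = (nts x).map fun i => (s, i) := nts_mapNT _ _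

@[simp] theorem tag_append (s : H.State ⊕ H.Edge) (x y : Form T H.Slot) :
    tag s (x ++ y) = tag s x ++ tag s y := mapNT_append _ _ _

@[simp] theorem mapNT_snd_tag (s : H.State ⊕ H.Edge) (x : Form T H.Slot) :
    mapNT (N := H.Tagged) (N' := H.Slot) Prod.snd (tag s x) = x := by
  rw [tag, mapNT_mapNT]
  exact mapNT_eq_self fun _ _ => rfl

/-- The tags between two turns: the traversal of an edge from or to the current state `q` may be
under way. -/
inductive Phase (H : SlotSystem T m) (q : H.State) (y : Form T H.Tagged) : Prop
  | resting (h : ∀ B ∈ nts y, B.1 = .inl q)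
  | marking (e : H.Edge) (he : H.src e = q) (h : ∀ B ∈ nts y, B.1 = .inl q ∨ B.1 = .inr e)
  | before (e : H.Edge) (he : H.src e = q)
      (h : ∀ B ∈ nts y, B.1 = .inr e ∨ (B.1 = .inl (H.tgt e) ∧ B.2 ≠ H.slot e))
  | after (e : H.Edge) (he : H.tgt e = q)
      (h : ∀ B ∈ nts y, (B.1 = .inr e ∧ B.2 ≠ H.slot e) ∨ B.1 = .inl q)

/-- The sentential forms between two turns. -/
def Sound (H : SlotSystem T m) (y : Form T H.Tagged) : Prop :=
  ∃ q, H.Reach (q, mapNT Prod.snd y) ∧ H.Phase q y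

theorem Sound.nodup {y : Form T H.Tagged} (h : H.Sound y) : (nts y).Nodup := by
  obtain ⟨q, hq, -⟩ := h
  have := hq.nodup
  rw [nts_mapNT] at this
  exact this.of_map

theorem exists_mem_of_reach {e : H.Edge} {y : Form T H.Tagged}
    (h : H.Reach (H.src e, mapNT Prod.snd y)) : ∃ B ∈ nts y, B.2 = H.slot e := by
  have := h.mem_nts_iff.2 (H.slot_mem e)
  rw [nts_mapNT] at this
  obtain ⟨B, hB, hBe⟩ := List.mem_map.1 this
  exact ⟨B, hB, hBe⟩

theorem Sound.mark {e : H.Edge} {i : H.Slot} {u v : Form T H.Tagged}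
    (h : H.Sound (u ++ [.nonterminal (.inl (H.src e), i)] ++ v))
    (hC : ∀ B ∈ nts (u ++ [.nonterminal (.inr e, i)] ++ v),
      H.TagIn (.inl (H.src e)) (.inr e) (.inl (H.src e), i) B) :
    H.Sound (u ++ [.nonterminal (.inr e, i)] ++ v) := by
  obtain ⟨q, hq, hph⟩ := h
  have hmem : (Sum.inl (H.src e), i) ∈ nts (u ++ [.nonterminal (.inl (H.src e), i)] ++ v) := by simp
  have hsq : H.src e = q := by
    cases hph with
    | resting h => simpa using h _ hmem
    | marking e' he' h => simpa using h _ hmem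
    -- Moved slots already carry the target of `e'`, from which another edge might start too early.
    -- But the slot that `e'` rewrites still has the tag `e'`, which the check tolerates only if `e'
    -- = e`.
    | before e' he' h =>
      subst he'
      obtain ⟨B, hB, hBe⟩ := exists_mem_of_reach hq
      have hB' : B.1 = .inr e' := (h B hB).resolve_right fun h => h.2 hBe
      have hBm : B ∈ nts (u ++ [.nonterminal (.inr e, i)] ++ v) := by
        have : B ≠ (.inl (H.src e), i) := by rintro rfl; simp at hB'
        simpa [this] using Or.imp_right Or.inr (by simpa [this] using hB)
      have h₁ := (hC B hBm).1
      rw [hB'] at h₁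
      obtain rfl : e' = e := by simpa using h₁
      rfl
    | after e' he' h => simpa using h _ hmem
  refine ⟨q, ?_, .marking e hsq fun B hB => hsq ▸ (hC B hB).1⟩
  simpa using hq

theorem Sound.move {e : H.Edge} {i : H.Slot} {u v : Form T H.Tagged} (hi : i ≠ H.slot e)
    (h : H.Sound (u ++ [.nonterminal (.inr e, i)] ++ v))
    (hC : ∀ B ∈ nts (u ++ [.nonterminal (.inl (H.tgt e), i)] ++ v),
      H.TagIn (.inr e) (.inl (H.tgt e)) (.inr e, i) B) :
    H.Sound (u ++ [.nonterminal (.inl (H.tgt e), i)] ++ v) := by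
  obtain ⟨q, hq, hph⟩ := h
  have hmem : (Sum.inr e, i) ∈ nts (u ++ [.nonterminal (.inr e, i)] ++ v) := by simp
  have hold : ∀ B ∈ nts (u ++ [.nonterminal (.inl (H.tgt e), i)] ++ v),
      B = (.inl (H.tgt e), i) ∨ B ∈ nts (u ++ [.nonterminal (.inr e, i)] ++ v) := by
    intro B hB
    simp only [nts_append, nts_nonterminal_cons, nts_nil, List.mem_append, List.mem_singleton]
      at hB ⊢
    tauto
  refine ⟨q, by simpa using hq, ?_⟩
  cases hph with
  | resting h => simpa using h _ hmem
  -- The first move shows that marking is complete: an old occurrence with the target tag is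
  -- impossible here, and the check excludes the source tag, so all the others carry `e`.
  | marking e' he' h =>
    obtain rfl : e = e' := by simpa using h _ hmem
    refine .before e he' fun B hB => (hC B hB).1.imp_right fun hBt => ⟨hBt, ?_⟩
    rcases hold B hB with rfl | hB'
    · exact hi
    · exfalso
      have := h B hB'
      rw [hBt, ← he'] at this
      exact H.src_ne_tgt e (by simpa [eq_comm] using this)
  | before e' he' h =>
    obtain rfl : e = e' := by simpa using h _ hmem
    refine .before e he' fun B hB => ?_
    rcases hold B hB with rfl | hB'
    · exact .inr ⟨rfl, hi⟩
    · exact h B hB'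
  | after e' he' h =>
    obtain rfl : e = e' := by simpa using (h _ hmem).imp_left And.left
    refine .after e he' fun B hB => ?_
    rcases hold B hB with rfl | hB'
    · exact .inr (by rw [he'])
    · exact h B hB'

/-- This is the moment at which the simulated state changes. All other turns leave the underlying
slot form as it is, and the remaining slots may be moved before or after. -/
theorem Sound.apply {e : H.Edge} {u v : Form T H.Tagged}
    (h : H.Sound (u ++ [.nonterminal (.inr e, H.slot e)] ++ v))
    (hC : ∀ B ∈ nts (u ++ tag (.inl (H.tgt e)) (H.out e) ++ v),
      H.TagIn (.inr e) (.inl (H.tgt e)) (.inr e, H.slot e) B) :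
    H.Sound (u ++ tag (.inl (H.tgt e)) (H.out e) ++ v) := by
  obtain ⟨q, hq, hph⟩ := h
  have hmem : (Sum.inr e, H.slot e) ∈ nts (u ++ [.nonterminal (.inr e, H.slot e)] ++ v) := by simp
  have hsq : H.src e = q := by
    cases hph with
    | resting h => simpa using h _ hmem
    | marking e' he' h =>
      obtain rfl : e = e' := by simpa using h _ hmem
      exact he'
    | before e' he' h =>
      obtain rfl : e = e' := by simpa using h _ hmem
      exact he'
    | after e' he' h =>
      rcases h _ hmem with ⟨h, h'⟩ | h
      · simp only [Sum.inr.injEq] at h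
        exact absurd (h ▸ rfl) h'
      · simp at h
  subst hsq
  simp only [mapNT_append, mapNT_nonterminal_cons, mapNT_nil] at hq
  refine ⟨H.tgt e, by simpa using hq.step, .after e rfl fun B hB => ?_⟩
  rcases (hC B hB).1 with hB' | hB'
  · exact .inl ⟨hB', fun h => (hC B hB).2 (Prod.ext hB' h)⟩
  · exact .inr hB'

theorem Sound.turn {P : Form T H.Tagged → Prop} {f : Mode} (hf : ∀ n p, f.Holds n p → p)
    {j : Option (H.Edge × H.Slot × Bool)} {x y : Form T H.Tagged} (h : H.Sound x)
    (hxy : Turn P f (H.maximalRules j) x y) : H.Sound y := by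
  match j, hxy with
  | none, ⟨n, hn, _⟩ =>
    cases hn with
    | zero => exact h
    | head hs _ => obtain ⟨⟨r, hr, -⟩, -⟩ := hs; exact hr.elim
  | some (e, i, false), hxy =>
    rcases hxy.of_checkRules hf (by simp) h.nodup with rfl | ⟨u, v, rfl, rfl, hC⟩
    · exact h
    · exact h.mark hC
  | some (e, i, true), hxy =>
    have hnot : (Sum.inr e, i) ∉ nts (H.moved e i) := by
      unfold moved
      split <;> simp
    rcases hxy.of_checkRules hf hnot h.nodup with rfl | ⟨u, v, rfl, rfl, hC⟩
    · exact h
    · by_cases hi : i = H.slot e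
      · subst hi
        rw [moved, if_pos rfl] at hC ⊢
        exact h.apply hC
      · rw [moved, if_neg hi] at hC ⊢
        exact h.move hi hC

/-- The turns of the components. -/
def MaximalTurn (H : SlotSystem T m) (P : Form T H.Tagged → Prop) (f : Mode)
    (x y : Form T H.Tagged) : Prop := ∃ j, Turn P f (H.maximalRules j) x y

theorem mem_language_of_maximalTurns {P : Form T H.Tagged → Prop} {f : Mode}
    (hf : ∀ n p, f.Holds n p → p) {w : List T}
    (h : ReflTransGen (H.MaximalTurn P f) [.nonterminal (.inl H.start, H.startSlot)]
      (ofWord H.Tagged w)) : w ∈ H.language := by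
  obtain ⟨q, hq, -⟩ := reflTransGen_invariant (I := H.Sound)
    (fun _ _ hx ⟨_, hxy⟩ => hx.turn hf hxy) h ⟨H.start, .refl, .resting (by simp)⟩
  rw [mapNT_ofWord] at hq
  exact ⟨q, hq⟩

/-- All slots of a factor of a sentential form can change their tags one after the other. -/
theorem retag {R : Form T H.Tagged → Form T H.Tagged → Prop} {Q : H.Slot → Prop}
    {s s' : H.State ⊕ H.Edge} (hss : s ≠ s')
    (hR : ∀ u i v, Q i → ntCount (u ++ [.nonterminal (s, i)] ++ v) ≤ m →
      (∀ B ∈ nts (u ++ [.nonterminal (s', i)] ++ v), H.TagIn s s' (s, i) B) →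
      R (u ++ [.nonterminal (s, i)] ++ v) (u ++ [.nonterminal (s', i)] ++ v))
    (b : Form T H.Slot) {c d : Form T H.Tagged} (hQ : ∀ i ∈ nts b, Q i)
    (hc : ∀ B ∈ nts c, B.1 = s ∨ B.1 = s') (hd : ∀ B ∈ nts d, B.1 = s ∨ B.1 = s')
    (hnd : ((nts (c ++ tag s b ++ d)).map Prod.snd).Nodup) (hm : ntCount (c ++ tag s b ++ d) ≤ m) :
    ReflTransGen R (c ++ tag s b ++ d) (c ++ tag s' b ++ d) := by
  induction b generalizing c with
  | nil => exact .refl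
  | cons a b ih =>
    cases a with
    | terminal a =>
      have := ih (c := c ++ [.terminal a]) hQ (by simpa using hc) (by simpa [tag] using hnd)
        (by simpa [tag] using hm)
      simpa [tag] using this
    | nonterminal i =>
      have h₁ := hR c i (tag s b ++ d) (hQ i (by simp)) (by simpa [tag] using hm) (by
        intro B hB
        have hB' : B ∈ nts c ∨ B = (s', i) ∨ (∃ k ∈ nts b, (s, k) = B) ∨ B ∈ nts d := by
          simpa [or_assoc] using hB
        constructor
        · rcases hB' with h | rfl | ⟨k, -, rfl⟩ | h
          · exact hc B h
          · exact .inr rfl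
          · exact .inl rfl
          · exact hd B h
        · rintro rfl
          simp only [tag, mapNT_nonterminal_cons, nts_append, nts_nonterminal_cons, nts_mapNT,
            List.map_append, List.map_cons, List.map_map, List.nodup_append, List.nodup_cons,
            List.mem_map, List.mem_append, List.mem_cons] at hnd
          rcases hB' with h | h | ⟨k, hk, h⟩ | h
          · exact hnd.1.2.2 i ⟨_, h, rfl⟩ i (.inl rfl) rfl
          · exact hss (congrArg Prod.fst h)
          · exact hnd.1.2.1.1 ⟨k, hk, congrArg Prod.snd h⟩
          · exact hnd.2.2 i (.inr (.inl rfl)) i ⟨_, h, rfl⟩ rfl)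
      have h₂ := ih (c := c ++ [.nonterminal (s', i)]) (fun k hk => hQ k (by simp [hk]))
        (by
          intro B hB
          rw [nts_append, List.mem_append] at hB
          rcases hB with hB | hB
          · exact hc B hB
          · exact .inr (by simp at hB; rw [hB]))
        (by simpa [tag] using hnd) (by simpa [tag, ntCount_eq_length] using hm)
      refine .head (b := c ++ [.nonterminal (s', i)] ++ (tag s b ++ d)) ?_ ?_
      · simpa [tag] using h₁
      · simpa [tag] using h₂

/-- All slots are marked, then all except `slot e` are moved, and `slot e` is rewritten last. -/
theorem turns_of_edge {f : Mode} {k : ℕ} (hf : ∀ p, p → f.Holds (k + 1) p) {e : H.Edge}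
    {u v : Form T H.Slot} (h : H.Reach (H.src e, u ++ [.nonterminal (H.slot e)] ++ v)) :
    ReflTransGen (H.MaximalTurn (fun x => ntCount x ≤ m) f)
      (tag (.inl (H.src e)) (u ++ [.nonterminal (H.slot e)] ++ v))
      (tag (.inl (H.tgt e)) (u ++ H.out e ++ v)) := by
  have hcount : ∀ s, ntCount (tag s (u ++ [.nonterminal (H.slot e)] ++ v)) ≤ m := fun s => by
    simpa [ntCount_eq_length] using h.ntCount_le
  have hnd := h.nodup
  have hmark := retag (H := H) (Q := fun _ => True) (s := .inl (H.src e)) (s' := .inr e) (by simp)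
    (R := H.MaximalTurn (fun x => ntCount x ≤ m) f)
    (fun u i v _ hm hC => ⟨some (e, i, false), turn_checkRules hf (fun h => h.2 rfl) hm
      (by simpa [ntCount_eq_length] using hm) hC⟩)
    (u ++ [.nonterminal (H.slot e)] ++ v) (c := []) (d := []) (by simp) (by simp) (by simp)
    (by simpa [Function.comp_def] using hnd) (by simpa using hcount _)
  have hmove := fun (b : Form T H.Slot) c d (hQ : ∀ i ∈ nts b, i ≠ H.slot e) =>
    retag (H := H) (Q := fun i => i ≠ H.slot e) (s := .inr e) (s' := .inl (H.tgt e)) (by simp)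
    (R := H.MaximalTurn (fun x => ntCount x ≤ m) f)
    (fun u i v hi hm hC => ⟨some (e, i, true), by
      have := turn_checkRules hf (A := (Sum.inr e, i)) (z := [.nonterminal (.inl (H.tgt e), i)])
        (P := fun x => ntCount x ≤ m)
        (C := H.TagIn (.inr e) (.inl (H.tgt e)) (.inr e, i)) (fun h => h.2 rfl) hm
        (by simpa [ntCount_eq_length] using hm) hC
      simpa only [maximalRules, moved, if_neg hi] using this⟩)
    b (c := c) (d := d) hQ
  have hu : ∀ i ∈ nts u, i ≠ H.slot e := by
    rintro i hi rfl
    simp only [nts_append, nts_nonterminal_cons, nts_nil, List.nodup_append] at hnd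
    exact hnd.1.2.2 _ hi _ (by simp) rfl
  have hv : ∀ i ∈ nts v, i ≠ H.slot e := by
    rintro i hi rfl
    simp only [nts_append, nts_nonterminal_cons, nts_nil, List.nodup_append] at hnd
    exact hnd.2.2 _ (by simp) _ hi rfl
  have h₁ := hmove u [] (tag (.inr e) ([.nonterminal (H.slot e)] ++ v)) hu (by simp)
    (by simp) (by simpa [Function.comp_def] using hnd)
    (by simpa using hcount (.inr e))
  have h₂ := hmove v (tag (.inl (H.tgt e)) u ++ tag (.inr e) [.nonterminal (H.slot e)]) [] hv
    (by simp [or_imp, forall_and]) (by simp) (by simpa [Function.comp_def] using hnd)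
    (by simpa [ntCount_eq_length] using hcount (.inr e))
  have h₃ : H.MaximalTurn (fun x => ntCount x ≤ m) f
      (tag (.inl (H.tgt e)) u ++ [.nonterminal (.inr e, H.slot e)] ++ tag (.inl (H.tgt e)) v)
      (tag (.inl (H.tgt e)) u ++ tag (.inl (H.tgt e)) (H.out e) ++ tag (.inl (H.tgt e)) v) := by
    refine ⟨some (e, H.slot e, true), ?_⟩
    rw [maximalRules, moved, if_pos rfl]
    refine turn_checkRules hf (fun h => h.2 rfl) ?_ ?_ ?_
    · simpa [ntCount_eq_length] using h.ntCount_le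
    · simpa [ntCount_eq_length] using h.step.ntCount_le
    · intro B hB
      have : B.1 = .inl (H.tgt e) := by
        rw [← tag_append, ← tag_append, nts_tag] at hB
        obtain ⟨i, -, rfl⟩ := List.mem_map.1 hB
        rfl
      exact ⟨.inr this, by rintro rfl; simp at this⟩
  rw [tag_append _ (u ++ H.out e), tag_append _ u]
  refine ReflTransGen.tail
    (b := tag (.inl (H.tgt e)) u ++ [.nonterminal (.inr e, H.slot e)] ++ tag (.inl (H.tgt e)) v)
    (ReflTransGen.trans (b := tag (.inr e) (u ++ [.nonterminal (H.slot e)] ++ v)) ?_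
    (ReflTransGen.trans (b := tag (.inl (H.tgt e)) u ++ tag (.inr e) ([.nonterminal (H.slot e)] ++ v))
      ?_ ?_)) h₃
  · simpa using hmark
  · simpa using h₁
  · simpa [tag] using h₂

theorem maximalTurns_of_reach {f : Mode} {k : ℕ} (hf : ∀ p, p → f.Holds (k + 1) p)
    {a : H.State × Form T H.Slot} (h : H.Reach a) :
    ReflTransGen (H.MaximalTurn (fun x => ntCount x ≤ m) f)
      [.nonterminal (.inl H.start, H.startSlot)] (tag (.inl a.1) a.2) := by
  induction h with
  | refl => exact .refl
  | tail h hs ih =>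
    obtain ⟨e, u, v, rfl, rfl⟩ := hs
    exact ih.trans (turns_of_edge hf h)

/-- The language of a slot system is generated by a grammar system in any mode that requires
maximal turns and admits them for some positive number of steps. -/
theorem mem_cdFamily_of_maximal (H : SlotSystem T m) (hm : 1 ≤ m) {X : RuleType}
    (hX : H.Allowed X) {f : Mode} {k : ℕ} (hf : ∀ n p, f.Holds n p → p)
    (hf' : ∀ p, p → f.Holds (k + 1) p) {L : Language T} (hL : SameLanguage H.language L) :
    L ∈ cdFamily T X f m := by
  have := H.finite_State
  have := H.finite_Edge
  have := H.finite_Slot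
  have : Finite (H.Edge × H.Slot × Bool) := inferInstance
  let J : Type u := Option (H.Edge × H.Slot × Bool)
  refine mem_cdFamily_of_turns (J := J) (N := H.Tagged) hm (.inl H.start, H.startSlot) H.maximalRules
    H.finite_maximalRules (H.allows_maximalRules hX) hL
    (fun w h => mem_language_of_maximalTurns hf h) ?_
  rintro w ⟨q, hq⟩
  have := maximalTurns_of_reach hf' hq
  rwa [tag, mapNT_ofWord] at this

end SlotSystem

/-! ### From slot systems to grammar systems in modes that require many steps -/

/-- One element receives the whole surplus `M - S.card`. A slot with counter `c` costs `c + 1`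
steps, which is why `M` must be at least the number of slots. -/
theorem exists_pad {α : Type*} {M : ℕ} {S : Finset α} (hS : S.Nonempty) (hM : S.card ≤ M) :
    ∃ p : α → Fin (M + 1), ∑ i ∈ S, ((p i).val + 1) = M := by
  classical
  obtain ⟨i₀, hi₀⟩ := hS
  refine ⟨fun i => if i = i₀ then ⟨M - S.card, by omega⟩ else 0, ?_⟩
  have h : ∀ i, (if i = i₀ then (⟨M - S.card, by omega⟩ : Fin (M + 1)) else 0).val
      = if i = i₀ then M - S.card else 0 := fun i => by split <;> rfl
  simp only [h, Finset.sum_add_distrib, Finset.sum_ite_eq' S i₀, if_pos hi₀, Finset.sum_const]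
  simp
  omega

namespace SlotSystem

variable {T : Type u} {m : ℕ} (H : SlotSystem T m) (M : ℕ)

/-- Slots with a state and a counter. -/
abbrev Counted : Type u := H.State × H.Slot × Fin (M + 1)

variable {H M} (pad : H.State → H.Slot → Fin (M + 1))

/-- Add a state, and the initial values of the counters, to the slots of a form. -/
def dress (q : H.State) (x : Form T H.Slot) : Form T (H.Counted M) :=
  mapNT (fun i => (q, i, pad q i)) x

/-- Remove the states and the counters. -/
def undress (y : Form T (H.Counted M)) : Form T H.Slot := mapNT (fun B => B.2.1) y

open Classical in
/-- The right-hand sides of the component of an edge: a counter is decreased, and if it is zero,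
then the edge is applied to the slot. -/
noncomputable def countedOut (e : H.Edge) (i : H.Slot) (c : Fin (M + 1)) :
    Form T (H.Counted M) :=
  if c.val = 0 then
    if i = H.slot e then dress pad (H.tgt e) (H.out e)
    else [.nonterminal (H.tgt e, i, pad (H.tgt e) i)]
  else [.nonterminal (H.src e, i, ⟨c.val - 1, by omega⟩)]

/-- The components: one for every edge. -/
def countedRules : Option H.Edge → Set (ContextFreeRule T (H.Counted M))
  | none => ∅
  | some e => Set.range fun p : H.Slot × Fin (M + 1) =>
      ⟨(H.src e, p.1, p.2), countedOut pad e p.1 p.2⟩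

theorem finite_countedRules (j : Option H.Edge) : (countedRules pad j).Finite := by
  have := H.finite_Slot
  match j with
  | none => exact Set.finite_empty
  | some e => exact Set.finite_range _

theorem allows_countedRules {X : RuleType} (hX : H.Allowed X) (j : Option H.Edge) :
    ∀ r ∈ countedRules pad j, X.Allows r := by
  intro r hr
  rw [RuleType.allows_iff]
  match j, hr with
  | some e, ⟨(i, c), hr⟩ =>
    subst hr
    change X = .CF ∨ countedOut pad e i c ≠ []
    unfold countedOut
    split
    · split
      · simpa [dress, mapNT_eq_nil] using hX e
      · simp
    · simp

/-- The number of steps that are left in a turn of a component working on the state `q`. -/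
noncomputable def stepsLeft (q : H.State) (y : Form T (H.Counted M)) : ℕ :=
  open Classical in ((nts y).map fun B => if B.1 = q then B.2.2.val + 1 else 0).sum

theorem stepsLeft_append (q : H.State) (x y : Form T (H.Counted M)) :
    stepsLeft q (x ++ y) = stepsLeft q x + stepsLeft q y := by
  simp [stepsLeft]

theorem stepsLeft_self (q : H.State) (i : H.Slot) (c : Fin (M + 1)) :
    stepsLeft q [.nonterminal (q, i, c)] = c.val + 1 := by
  simp [stepsLeft]

theorem stepsLeft_dress (q : H.State) (x : Form T H.Slot) :
    stepsLeft q (dress pad q x) = ((nts x).map fun i => (pad q i).val + 1).sum := by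
  simp [stepsLeft, dress, Function.comp_def]

theorem stepsLeft_dress_of_ne {q q' : H.State} (h : q' ≠ q) (x : Form T H.Slot) :
    stepsLeft q (dress pad q' x) = 0 := by
  simp [stepsLeft, dress, Function.comp_def, h]

theorem undress_dress (q : H.State) (x : Form T H.Slot) : undress (dress pad q x) = x := by
  rw [undress, dress, mapNT_mapNT]
  exact mapNT_eq_self fun _ _ => rfl

/-- The forms in the course of a turn of the component of `e`. -/
inductive Traversal (e : H.Edge) (y : Form T (H.Counted M)) : Prop
  | before (hy : H.Reach (H.src e, undress y))
      (h : ∀ B ∈ nts y, B.1 = H.src e ∨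
        B.1 = H.tgt e ∧ B.2.2 = pad (H.tgt e) B.2.1 ∧ B.2.1 ≠ H.slot e)
  | after (hy : H.Reach (H.tgt e, undress y))
      (h : ∀ B ∈ nts y, B.1 = H.src e ∧ B.2.1 ≠ H.slot e ∨
        B.1 = H.tgt e ∧ B.2.2 = pad (H.tgt e) B.2.1)

/-! ### Turns of exactly `M` steps -/

variable {pad}

/-- Every rule costs one unit: it decreases a counter, or it moves a slot with counter zero to the
target state, whose slots are not counted. -/
theorem Traversal.step {e : H.Edge} {y y' : Form T (H.Counted M)} (h : Traversal pad e y)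
    (hs : RuleStep (countedRules pad (some e)) y y') :
    Traversal pad e y' ∧ stepsLeft (H.src e) y = stepsLeft (H.src e) y' + 1 := by
  obtain ⟨_, ⟨⟨i, c⟩, rfl⟩, hrw⟩ := hs
  obtain ⟨u, v, rfl, rfl⟩ := ContextFreeRule.rewrites_iff.1 hrw
  dsimp only at h ⊢
  have hmem : (H.src e, i, c) ∈ nts (u ++ [.nonterminal (H.src e, i, c)] ++ v) := by simp
  have hne : H.tgt e ≠ H.src e := (H.src_ne_tgt e).symm
  have huv : ∀ B, B ∈ nts u ∨ B ∈ nts v → B ∈ nts (u ++ [.nonterminal (H.src e, i, c)] ++ v) := by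
    intro B hB
    simp only [nts_append, List.mem_append]
    tauto
  simp only [stepsLeft_append, stepsLeft_self]
  by_cases hc : c.val = 0
  · by_cases hi : i = H.slot e
    · subst hi
      simp only [countedOut, hc, if_true]
      refine ⟨?_, by rw [stepsLeft_dress_of_ne pad hne]; omega⟩
      cases h with
      | after hy h => simpa [hne.symm] using h _ hmem
      | before hy h =>
        have hnd := hy.nodup
        simp only [undress, mapNT_append, mapNT_nonterminal_cons, mapNT_nil] at hy hnd
        refine .after ?_ fun B hB => ?_
        · have := hy.step
          rw [← undress_dress pad (H.tgt e) (H.out e)] at this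
          simpa [undress] using this
        · have hB' : (B ∈ nts u ∨ B ∈ nts v) ∨ B ∈ nts (dress pad (H.tgt e) (H.out e)) := by
            simp only [nts_append, List.mem_append] at hB
            tauto
          rcases hB' with hB' | hB'
          · refine (h B (huv B hB')).imp (fun h => ⟨h, fun hBs => ?_⟩) fun h => ⟨h.1, h.2.1⟩
            simp only [nts_append, nts_mapNT, nts_nonterminal_cons, nts_nil,
              List.nodup_append, List.mem_append] at hnd
            rcases hB' with hB' | hB'
            · exact hnd.1.2.2 _ (List.mem_map_of_mem hB') _ (List.mem_singleton_self _) hBs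
            · exact hnd.2.2 _ (.inr (List.mem_singleton_self _)) _ (List.mem_map_of_mem hB') hBs.symm
          · rw [dress, nts_mapNT] at hB'
            obtain ⟨k, -, rfl⟩ := List.mem_map.1 hB'
            exact .inr ⟨rfl, rfl⟩
    · simp only [countedOut, hc, hi, if_true, if_false]
      refine ⟨?_, by simp [stepsLeft, hne]; omega⟩
      have hB' : ∀ B ∈ nts (u ++ [.nonterminal (H.tgt e, i, pad (H.tgt e) i)] ++ v),
          (B ∈ nts u ∨ B ∈ nts v) ∨ B = (H.tgt e, i, pad (H.tgt e) i) := by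
        intro B hB
        simp only [nts_append, List.mem_append, nts_nonterminal_cons, nts_nil,
          List.mem_singleton] at hB
        tauto
      cases h with
      | before hy h =>
        refine .before (by simpa [undress] using hy) fun B hB => ?_
        rcases hB' B hB with hB | rfl
        · exact h B (huv B hB)
        · exact .inr ⟨rfl, rfl, hi⟩
      | after hy h =>
        refine .after (by simpa [undress] using hy) fun B hB => ?_
        rcases hB' B hB with hB | rfl
        · exact h B (huv B hB)
        · exact .inr ⟨rfl, rfl⟩
  · simp only [countedOut, hc, if_false, stepsLeft_self]
    refine ⟨?_, by omega⟩
    have hB' : ∀ B ∈ nts (u ++ [.nonterminal (H.src e, i, ⟨c.val - 1, by omega⟩)] ++ v),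
        (B ∈ nts u ∨ B ∈ nts v) ∨ B = (H.src e, i, ⟨c.val - 1, by omega⟩) := by
      intro B hB
      simp only [nts_append, List.mem_append, nts_nonterminal_cons, nts_nil,
        List.mem_singleton] at hB
      tauto
    cases h with
    | before hy h =>
      refine .before (by simpa [undress] using hy) fun B hB => ?_
      rcases hB' B hB with hB | rfl
      · exact h B (huv B hB)
      · exact .inl rfl
    | after hy h =>
      refine .after (by simpa [undress] using hy) fun B hB => ?_
      rcases hB' B hB with hB | rfl
      · exact h B (huv B hB)
      · exact .inl ⟨rfl, by simpa [hne.symm] using h _ hmem⟩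

/-- With no source tag left, the edge has been applied, since before that `slot e` would still carry
the source. -/
theorem Traversal.finished {e : H.Edge} {y : Form T (H.Counted M)} (h : Traversal pad e y)
    (h0 : stepsLeft (H.src e) y = 0) : ∃ x, H.Reach (H.tgt e, x) ∧ y = dress pad (H.tgt e) x := by
  have hsrc : ∀ B ∈ nts y, B.1 ≠ H.src e := by
    intro B hB hBs
    have := List.sum_eq_zero_iff.1 h0 _ (List.mem_map_of_mem hB)
    simp [hBs] at this
  cases h with
  | before hy h =>
    have := hy.mem_nts_iff.2 (H.slot_mem e)
    rw [undress, nts_mapNT] at this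
    obtain ⟨B, hB, hBs⟩ := List.mem_map.1 this
    exact absurd hBs ((h B hB).resolve_left (hsrc B hB)).2.2
  | after hy h =>
    refine ⟨_, hy, ?_⟩
    rw [dress, undress, mapNT_mapNT]
    refine (mapNT_eq_self fun B hB => ?_).symm
    obtain ⟨h₁, h₂⟩ := (h B hB).resolve_left fun h => hsrc B hB h.1
    exact Prod.ext h₁.symm (Prod.ext rfl h₂.symm)

theorem sum_pad (hpad : ∀ q, (H.used q).Nonempty → ∑ i ∈ H.used q, ((pad q i).val + 1) = M)
    {e : H.Edge} {x : Form T H.Slot} (h : H.Reach (H.src e, x)) :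
    ((nts x).map fun i => (pad (H.src e) i).val + 1).sum = M := by
  refine Eq.trans ?_ (hpad (H.src e) ⟨_, H.slot_mem e⟩)
  rw [Finset.sum_eq_multiset_sum, ← h.fits]
  simp

variable (pad) in
/-- The sentential forms between two turns. -/
def Dressed (y : Form T (H.Counted M)) : Prop := ∃ q x, H.Reach (q, x) ∧ y = dress pad q x

/-- A turn begins with exactly `M` units and must make at least `M` steps, so it uses all units and
ends with the edge fully traversed. -/
theorem Dressed.turn (hM : 1 ≤ M)
    (hpad : ∀ q, (H.used q).Nonempty → ∑ i ∈ H.used q, ((pad q i).val + 1) = M)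
    {P : Form T (H.Counted M) → Prop} {f : Mode} (hf : ∀ n p, f.Holds n p → M ≤ n)
    {j : Option H.Edge} {y y' : Form T (H.Counted M)} (h : Dressed pad y)
    (ht : Turn P f (countedRules pad j) y y') : Dressed pad y' := by
  obtain ⟨n, hit, hn⟩ := ht
  have hMn := hf _ _ hn
  obtain ⟨q, x, hq, rfl⟩ := h
  match j with
  | none =>
    cases hit with
    | zero => omega
    | head hs _ => obtain ⟨⟨r, hr, -⟩, -⟩ := hs; exact hr.elim
  | some e =>
    -- As `M ≥ 1`, there is a first step, and it is possible only if the component works on the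
    -- current state.
    have hqe : H.src e = q := by
      cases hit with
      | zero => omega
      | head hs _ =>
        obtain ⟨⟨_, ⟨⟨i, c⟩, rfl⟩, hrw⟩, -⟩ := hs
        obtain ⟨u, v, hu, -⟩ := ContextFreeRule.rewrites_iff.1 hrw
        have : (H.src e, i, c) ∈ nts (dress pad q x) := by rw [hu]; simp
        rw [dress, nts_mapNT] at this
        obtain ⟨k, -, hk⟩ := List.mem_map.1 this
        exact (congrArg Prod.fst hk).symm
    subst hqe
    have hinv := hit.invariant (k := 0)
      (I := fun k y => Traversal pad e y ∧ stepsLeft (H.src e) y + k = M)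
      (fun k a b ha hab => by
        obtain ⟨h₁, h₂⟩ := ha.1.step hab.1
        exact ⟨h₁, by omega⟩)
      ⟨.before (by rwa [undress_dress]) (by simp [dress]),
        by rw [stepsLeft_dress, sum_pad hpad hq]; rfl⟩
    obtain ⟨x', hx', rfl⟩ := hinv.1.finished (by omega)
    exact ⟨_, x', hx', rfl⟩

theorem mem_language_of_countedTurns (hM : 1 ≤ M)
    (hpad : ∀ q, (H.used q).Nonempty → ∑ i ∈ H.used q, ((pad q i).val + 1) = M)
    {P : Form T (H.Counted M) → Prop} {f : Mode} (hf : ∀ n p, f.Holds n p → M ≤ n) {w : List T}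
    (h : ReflTransGen (fun a b => ∃ j, Turn P f (countedRules pad j) a b)
      [.nonterminal (H.start, H.startSlot, pad H.start H.startSlot)] (ofWord (H.Counted M) w)) :
    w ∈ H.language := by
  obtain ⟨q, x, hq, hx⟩ := reflTransGen_invariant (I := Dressed pad)
    (fun _ _ hx ⟨_, hxy⟩ => hx.turn hM hpad hf hxy) h ⟨H.start, _, .refl, rfl⟩
  obtain ⟨w', rfl⟩ := exists_ofWord_of_nts_eq_nil (x := x) (by
    simpa [dress] using congrArg nts hx.symm)
  rw [dress, mapNT_ofWord] at hx
  obtain rfl := ofWord_injective hx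
  exact ⟨q, hq⟩

/-- The steps of the component of `e` with bounded index. -/
def CountedStep (pad : H.State → H.Slot → Fin (M + 1)) (e : H.Edge)
    (a b : Form T (H.Counted M)) : Prop :=
  RuleStep (countedRules pad (some e)) a b ∧ ntCount b ≤ m

theorem ruleStep_counted (e : H.Edge) (i : H.Slot) (c : Fin (M + 1)) (u v : Form T (H.Counted M)) :
    RuleStep (countedRules pad (some e)) (u ++ [.nonterminal (H.src e, i, c)] ++ v)
      (u ++ countedOut pad e i c ++ v) :=
  ⟨_, ⟨(i, c), rfl⟩, ContextFreeRule.rewrites_iff.2 ⟨u, v, rfl, rfl⟩⟩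

theorem iter_countedStep (e : H.Edge) (i : H.Slot) {u v : Form T (H.Counted M)} (k : ℕ)
    (hk : k < M + 1) (hm : ntCount (u ++ [.nonterminal (H.src e, i, ⟨k, hk⟩)] ++ v) ≤ m)
    (hm' : ntCount (u ++ countedOut pad e i 0 ++ v) ≤ m) :
    Iter (CountedStep pad e) (k + 1) (u ++ [.nonterminal (H.src e, i, ⟨k, hk⟩)] ++ v)
      (u ++ countedOut pad e i 0 ++ v) := by
  induction k with
  | zero => exact .single ⟨ruleStep_counted e i 0 u v, hm'⟩
  | succ k ih =>
    have hm'' : ntCount (u ++ [.nonterminal (H.src e, i, ⟨k, by omega⟩)] ++ v) ≤ m := by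
      simpa [ntCount_eq_length] using hm
    refine .head ⟨?_, hm''⟩ (ih (by omega) hm'')
    have := ruleStep_counted (pad := pad) e i ⟨k + 1, hk⟩ u v
    simpa only [countedOut, Nat.succ_ne_zero, if_false, Nat.add_sub_cancel] using this

theorem iter_countedStep_dress (e : H.Edge) (b : Form T H.Slot) {c d : Form T (H.Counted M)}
    (hb : ∀ i ∈ nts b, i ≠ H.slot e) (hm : ntCount (c ++ dress pad (H.src e) b ++ d) ≤ m) :
    Iter (CountedStep pad e) ((nts b).map fun i => (pad (H.src e) i).val + 1).sum
      (c ++ dress pad (H.src e) b ++ d) (c ++ dress pad (H.tgt e) b ++ d) := by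
  induction b generalizing c with
  | nil => exact .zero _
  | cons a b ih =>
    cases a with
    | terminal a =>
      have := ih (c := c ++ [.terminal a]) hb (by simpa [dress] using hm)
      simpa [dress] using this
    | nonterminal i =>
      have hi : countedOut pad e i 0 = [.nonterminal (H.tgt e, i, pad (H.tgt e) i)] := by
        simp [countedOut, hb i (by simp)]
      have h₁ := iter_countedStep (pad := pad) e i (u := c) (v := dress pad (H.src e) b ++ d)
        (pad (H.src e) i).val (pad (H.src e) i).isLt (by simpa [dress] using hm)
        (by simpa [dress, hi, ntCount_eq_length] using hm)
      have h₂ := ih (c := c ++ [.nonterminal (H.tgt e, i, pad (H.tgt e) i)])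
        (fun k hk => hb k (by simp [hk])) (by simpa [dress, ntCount_eq_length] using hm)
      rw [hi] at h₁
      rw [List.append_assoc _ (dress pad (H.src e) b) d] at h₂
      simpa [dress] using h₁.trans h₂

/-- The slots are processed from left to right. Each intermediate form has as many nonterminals as
the form before or the form after the edge, and the costs add up to `M`. -/
theorem iter_countedStep_of_edge {e : H.Edge} {u v : Form T H.Slot}
    (hpad : ∀ q, (H.used q).Nonempty → ∑ i ∈ H.used q, ((pad q i).val + 1) = M)
    (h : H.Reach (H.src e, u ++ [.nonterminal (H.slot e)] ++ v)) :
    Iter (CountedStep pad e) M (dress pad (H.src e) (u ++ [.nonterminal (H.slot e)] ++ v))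
      (dress pad (H.tgt e) (u ++ H.out e ++ v)) := by
  have hcount := h.ntCount_le
  have hcount' := h.step.ntCount_le
  have hnd := h.nodup
  simp only [nts_append, nts_nonterminal_cons, nts_nil, List.nodup_append] at hnd
  have hu : ∀ i ∈ nts u, i ≠ H.slot e := fun i hi => hnd.1.2.2 _ hi _ (by simp)
  have hv : ∀ i ∈ nts v, i ≠ H.slot e := fun i hi => (hnd.2.2 _ (by simp) _ hi).symm
  have hout : countedOut pad e (H.slot e) 0 = dress pad (H.tgt e) (H.out e) := by simp [countedOut]
  have h₁ := iter_countedStep_dress (pad := pad) e u (c := [])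
    (d := dress pad (H.src e) ([.nonterminal (H.slot e)] ++ v)) hu
    (by simpa [dress, ntCount_eq_length] using hcount)
  have h₂ := iter_countedStep (pad := pad) e (H.slot e) (u := dress pad (H.tgt e) u)
    (v := dress pad (H.src e) v) (pad (H.src e) (H.slot e)).val (pad (H.src e) (H.slot e)).isLt
    (by simpa [dress, ntCount_eq_length] using hcount)
    (by rw [hout]; simpa [dress, ntCount_eq_length] using hcount')
  have h₃ := iter_countedStep_dress (pad := pad) e v
    (c := dress pad (H.tgt e) u ++ dress pad (H.tgt e) (H.out e)) (d := []) hv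
    (by simpa [dress, ntCount_eq_length] using hcount')
  rw [hout] at h₂
  refine Iter.of_eq (sum_pad hpad h) ?_
  have h₁₂ := Iter.trans (by simpa [dress] using h₁) (Iter.trans (by simpa [dress] using h₂)
    (by simpa [dress] using h₃))
  simpa [dress, Nat.add_assoc] using h₁₂

theorem countedTurns_of_reach {f : Mode} (hf : ∀ p, f.Holds M p)
    (hpad : ∀ q, (H.used q).Nonempty → ∑ i ∈ H.used q, ((pad q i).val + 1) = M)
    {a : H.State × Form T H.Slot} (h : H.Reach a) :
    ReflTransGen (fun a b => ∃ j, Turn (fun x => ntCount x ≤ m) f (countedRules pad j) a b)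
      [.nonterminal (H.start, H.startSlot, pad H.start H.startSlot)] (dress pad a.1 a.2) := by
  induction h with
  | refl => exact .refl
  | tail h hs ih =>
    obtain ⟨e, u, v, rfl, rfl⟩ := hs
    exact ih.tail ⟨some e, M, iter_countedStep_of_edge hpad h, hf _⟩

/-- The language of a slot system is generated by a grammar system in any mode that admits
exactly those turns that have some number `M ≥ m` of steps, and possibly longer ones. -/
theorem mem_cdFamily_of_counted (H : SlotSystem T m) (hm : 1 ≤ m) {X : RuleType}
    (hX : H.Allowed X) {M : ℕ} (hM : m ≤ M) {f : Mode} (hf : ∀ n p, f.Holds n p → M ≤ n)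
    (hf' : ∀ p, f.Holds M p) {L : Language T} (hL : SameLanguage H.language L) :
    L ∈ cdFamily T X f m := by
  have := H.finite_State
  have := H.finite_Edge
  have := H.finite_Slot
  have hex : ∀ q, ∃ p : H.Slot → Fin (M + 1),
      (H.used q).Nonempty → ∑ i ∈ H.used q, ((p i).val + 1) = M := fun q => by
    by_cases hq : (H.used q).Nonempty
    · obtain ⟨p, hp⟩ := exists_pad hq ((H.card_used q).trans hM)
      exact ⟨p, fun _ => hp⟩
    · exact ⟨fun _ => 0, fun h => absurd h hq⟩
  choose pad hpad using hex
  refine mem_cdFamily_of_turns (J := Option H.Edge) (N := H.Counted M) hm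
    (H.start, H.startSlot, pad H.start H.startSlot) (countedRules pad)
    (finite_countedRules pad) (allows_countedRules pad hX) hL
    (fun w h => mem_language_of_countedTurns (hm.trans hM) hpad hf h) ?_
  rintro w ⟨q, hq⟩
  have := countedTurns_of_reach hf' hpad hq
  rwa [dress, mapNT_ofWord] at this

/-- The language of a slot system is generated by a grammar system in any of the modes in `FI`. -/
theorem mem_cdFamily (H : SlotSystem T m) (hm : 1 ≤ m) {X : RuleType} (hX : H.Allowed X)
    {f : Mode} (hf : FI m f) {L : Language T} (hL : SameLanguage H.language L) :
    L ∈ cdFamily T X f m := by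
  cases hf with
  | t =>
    exact H.mem_cdFamily_of_maximal hm hX (k := 0) (f := .basic .t) (fun _ _ h => h)
      (fun _ h => h) hL
  | eq M h =>
    exact H.mem_cdFamily_of_counted hm hX h (f := .basic (.eq M)) (fun _ _ h => Eq.ge h)
      (fun _ => rfl) hL
  | ge M h =>
    exact H.mem_cdFamily_of_counted hm hX h (f := .basic (.ge M)) (fun _ _ h => h)
      (fun _ => le_refl M) hL
  | geLe M M' h h' =>
    exact H.mem_cdFamily_of_counted hm hX h (f := .and (.ge M) (.le M')) (fun _ _ h => h.1)
      (fun _ => ⟨le_refl M, h'⟩) hL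
  | tEq k h =>
    exact H.mem_cdFamily_of_maximal hm hX (k := k - 1) (f := .and .t (.eq k)) (fun _ _ h => h.1)
      (fun _ hp => ⟨hp, Nat.sub_add_cancel h⟩) hL
  | tLe k h =>
    exact H.mem_cdFamily_of_maximal hm hX (k := k - 1) (f := .and .t (.le k)) (fun _ _ h => h.1)
      (fun _ hp => ⟨hp, (Nat.sub_add_cancel h).le⟩) hL
  | tGe k h =>
    exact H.mem_cdFamily_of_maximal hm hX (k := k - 1) (f := .and .t (.ge k)) (fun _ _ h => h.1)
      (fun _ hp => ⟨hp, (Nat.sub_add_cancel h).ge⟩) hL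

end SlotSystem

theorem hcdFamily_mono {T : Type u} {X : RuleType} {F F' : Set Mode} (h : F ⊆ F') (m : ℕ) :
    hcdFamily T X F m ⊆ hcdFamily T X F' m := by
  intro L hL
  obtain ⟨G, hG, hGL⟩ := mem_familyOfIndex_iff.1 hL
  exact mem_familyOfIndex_iff.2 ⟨G, ⟨hG.1, fun i => h (hG.2 i)⟩, hGL⟩

end GrammarSystems

/-! ### The theorem as a cycle of inclusions -/

open GrammarSystems in
theorem mainTheorem1 (T : Type u) [Finite T] (m : ℕ) (hm : 1 ≤ m) (X : RuleType)
    (f : Mode) (hf : FI m f) :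
    programmedFamily T X m = cdFamily T X f m ∧
    cdFamily T X f m = hcdFamily T X hybridModes m := by
  have hcd : ∀ f, FI m f → programmedFamily T X m ⊆ cdFamily T X f m := fun f hf L hL =>
    let ⟨H, hH, hHL⟩ := exists_slotSystem_of_mem_programmedFamily hm hL
    H.mem_cdFamily hm hH hf hHL
  have hprog : ∀ F, hcdFamily T X F m ⊆ programmedFamily T X m := fun F L hL =>
    let ⟨H, hH, hHL⟩ := exists_slotSystem_of_mem_hcdFamily hm hL
    H.mem_programmedFamily hm hH hHL
  have heq : programmedFamily T X m = cdFamily T X f m := (hcd f hf).antisymm (hprog {f})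
  -- The mode `(t ∧ = 1)` lies in `FI m` for every `m` and is also a hybrid mode, so it links
  -- programmed grammars to the hybrid family.
  have hhyb : ({.and .t (.eq 1)} : Set Mode) ⊆ hybridModes := by
    rintro _ rfl
    exact ⟨1, le_rfl, .inl rfl⟩
  exact ⟨heq, heq ▸ ((hcd _ (.tEq 1 le_rfl)).trans (hcdFamily_mono hhyb m)).antisymm (hprog _)⟩
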